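/- Let $K,N\ge 2$ be integers and put $[n]=\{1,\dots,n\}$. A $(K,N)$ device-to-device private caching system with a trusted server is the following. The library consists of $N$ independent files $F_1,\dots,F_N$ of $B$ i.i.d. uniform bits each. User $k\in[K]$ has a cache $Z_k=(\mathscr M(C_k),C_k)$, where $C_k$ is the cached content and the metadata $\mathscr M(C_k)$ describes how $C_k$ is composed from the library, so that $C_k$ is a function of $\mathscr M(C_k)$ and the library. The placement is \emph{uncoded}: $C_k$ consists of bits copied directly from the files, at positions determined by $\mathscr M(C_k)$. The demand vector $\mathbf D=(D_1,\dots,D_K)\in[N]^K$ has a fixed law giving positive probability to every element of $[N]^K$. The variables $\mathscr M(C_1),\dots,\mathscr M(C_K)$ (which may be jointly random) are independent of $\mathbf D$. The trusted server, knowing $\mathbf D$ and $\mathscr M(C_1),\dots,\mathscr M(C_K)$ but having no access to the library, sends (possibly at random) to each user $k$ metadata $\mathscr M(P_k)$ describing how a packet $P_k$ is composed from the library, so that $P_k$ is a function of $\mathscr M(P_k)$ and the library. The library is independent of $\mathbf D$ and of all metadata, and all metadata take finitely many values. User $k$ broadcasts $X_k=(\mathscr M(P_k),P_k)$ to all users;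 write $\mathbf X=(X_1,\dots,X_K)$. Let $M\in[N/K,N]$. With entropies in bits, a load $R$ is \emph{achievable} at cache size $M$ under uncoded cache placement and user collusion if there are $\epsilon_B\ge 0$ with $\epsilon_B\to 0$ as $B\to\infty$ such that, for every sufficiently large $B$, some such system with uncoded placement satisfies $$H(Z_k)\le B(M+\epsilon_B),\qquad H(X_k\mid \mathscr M(P_k),Z_k)=0,\qquad H(F_{D_k}\mid \mathbf X,Z_k,D_k)\le B\epsilon_B\qquad (k\in[K]),$$ $$I\big(\mathbf D;\mathbf X,(Z_k)_{k\in S}\mid (D_k)_{k\in S}\big)=0\quad\text{for every nonempty } S\subseteq[K],\qquad \sum_{k\in[K]}H(X_k)\le B(R+\epsilon_B).$$ Let $R^\star_{\mathrm{u,c}}(M)$ be the infimum of all achievable loads. Let $R_{\mathrm A}(M)$, the load of Scheme A, be the value at $M$ of the lower convex envelope of the points $$\left(\frac{N+t-1}{K},\ \frac{\binom{U}{t}-\binom{U-N}{t}}{\binom{U}{t-1}}\right),\qquad t=1,\dots,U+1,\qquad U=(K-1)N .$$ Then for all integers $K,N\ge 2$ and every $M\in[N/K,N]$, Scheme A is order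 optimal within a factor of $18$ under uncoded cache placement and user collusion: the load $R_{\mathrm A}(M)$ is achievable at cache size $M$ under uncoded cache placement and user collusion, and $$R_{\mathrm A}(M)\le 18\,R^\star_{\mathrm{u,c}}(M).$$ -/

import Mathlib

open Finset Filter Topology

/-! ## Entropy of finite random variables

A finite probability space is a `Fintype` `Ω` with a weight function `w : Ω → ℝ`
(nonnegative, of total mass one).  All information measures are in bits. -/

namespace FiniteEntropy

variable {Ω α β γ : Type*} [Fintype Ω]

open Classical in
/-- The probability `Pr[X = x]`. -/
noncomputable def prob (w : Ω → ℝ) (X : Ω → α) (x : α) : ℝ :=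
  ∑ ω with X ω = x, w ω

open Classical in
/-- Shannon entropy `H(X) = - ∑ x, Pr[X = x] log₂ Pr[X = x]`; the sum runs over the values of `X`. -/
noncomputable def entropy (w : Ω → ℝ) (X : Ω → α) : ℝ :=
  ∑ x ∈ Finset.univ.image X, -(prob w X x * Real.logb 2 (prob w X x))

/-- Conditional entropy `H(X | Y) = H(X, Y) - H(Y)`. -/
noncomputable def condEntropy (w : Ω → ℝ) (X : Ω → α) (Y : Ω → β) : ℝ :=
  entropy w (fun ω => (X ω, Y ω)) - entropy w Y

/-- Conditional mutual information `I(X ; Y | Z) = H(X | Z) - H(X | Y, Z)`. -/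
noncomputable def condMutualInfo (w : Ω → ℝ) (X : Ω → α) (Y : Ω → β) (Z : Ω → γ) : ℝ :=
  condEntropy w X Z - condEntropy w X (fun ω => (Y ω, Z ω))

end FiniteEntropy

open FiniteEntropy

/-! ## The `(K, N)` D2D private caching system with a trusted server -/

namespace D2DCaching

/-- A realization of the library: `N` files of `B` bits each. -/
abbrev Library (N B : ℕ) : Type := Fin N → Fin B → Bool

/-- A demand vector: user `k` demands the file with index `d k`. -/
abbrev Demand (K N : ℕ) : Type := Fin K → Fin N

/-- A caching scheme for `K` users and `N` files of `B` bits.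

* `C k` is the (finite) set of values of the metadata `M(C_k)` of the cached content of user `k`, and
  `P k` the set of values of the metadata `M(P_k)` of the packets broadcast by user `k`.
* `placement` is the joint law of `(M(C_1), …, M(C_K))`; it depends neither on the demands nor on
  the library.
* `query d c` is the joint law of `(M(P_1), …, M(P_K))` chosen by the trusted server, who knows the
  demand vector `d` and the cache metadata `c` and has no access to the library.
* Metadata describe how a bit string is composed from the library: `content k c` and
  `payload k q` are the functions of the library that give the cached content `C_k` and the
  broadcast packets `P_k` when the metadata have the values `c` and `q`. -/
structure Scheme (K N B : ℕ) where
  C : Fin K → Type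
  P : Fin K → Type
  fintypeC : ∀ k, Fintype (C k)
  fintypeP : ∀ k, Fintype (P k)
  placement : (∀ k, C k) → ℝ
  placement_mem : placement ∈ stdSimplex ℝ (∀ k, C k)
  query : Demand K N → (∀ k, C k) → (∀ k, P k) → ℝ
  query_mem : ∀ d c, query d c ∈ stdSimplex ℝ (∀ k, P k)
  content : ∀ k, C k → Library N B → List Bool
  payload : ∀ k, P k → Library N B → List Bool

attribute [instance] Scheme.fintypeC Scheme.fintypeP

namespace Scheme

variable {K N B : ℕ} (S : Scheme K N B)

/-- The sample space: demands, cache metadata, packet metadata and library. -/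
abbrev Sample : Type :=
  Demand K N × (∀ k, S.C k) × (∀ k, S.P k) × Library N B

/-- The joint law: the demand vector has law `μ`, the cache metadata are independent of the
demands, the packet metadata are drawn by the server given both, and the library consists of
`N * B` independent uniform bits, independent of everything else. -/
noncomputable def law (μ : Demand K N → ℝ) (ω : S.Sample) : ℝ :=
  μ ω.1 * S.placement ω.2.1 * S.query ω.1 ω.2.1 ω.2.2.1 * (1 / 2 : ℝ) ^ (N * B)

/-- The demand vector `D`. -/
def D (ω : S.Sample) : Demand K N := ω.1

/-- The library `F`. -/
def F (ω : S.Sample) : Library N B := ω.2.2.2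

/-- The metadata `M(P_k)`. -/
def metaP (k : Fin K) (ω : S.Sample) : S.P k := ω.2.2.1 k

/-- The cache `Z_k = (M(C_k), C_k)`. -/
def Z (k : Fin K) (ω : S.Sample) : S.C k × List Bool :=
  (ω.2.1 k, S.content k (ω.2.1 k) (S.F ω))

/-- The signal `X_k = (M(P_k), P_k)` broadcast by user `k`. -/
def X (k : Fin K) (ω : S.Sample) : S.P k × List Bool :=
  (S.metaP k ω, S.payload k (S.metaP k ω) (S.F ω))

/-- All broadcast signals. -/
def allX (ω : S.Sample) : ∀ k, S.P k × List Bool := fun k => S.X k ω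

/-- The placement is uncoded: each user directly copies some bits of the library, whose positions
(file index, bit index) are determined by the metadata of its cache. -/
def Uncoded : Prop :=
  ∀ k (c : S.C k), ∃ pos : List (Fin N × Fin B),
    ∀ f : Library N B, S.content k c f = pos.map fun p => f p.1 p.2

/-- Cache size constraint `H(Z_k) ≤ B (M + ε)`. -/
def CacheSize (μ : Demand K N → ℝ) (M ε : ℝ) : Prop :=
  ∀ k, entropy (S.law μ) (S.Z k) ≤ B * (M + ε)

/-- Encoding constraint `H(X_k | M(P_k), Z_k) = 0`. -/
def Encoding (μ : Demand K N → ℝ) : Prop :=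
  ∀ k, condEntropy (S.law μ) (S.X k) (fun ω => (S.metaP k ω, S.Z k ω)) = 0

/-- Decoding constraint `H(F_{D_k} | X, Z_k, D_k) ≤ B ε`. -/
def Decoding (μ : Demand K N → ℝ) (ε : ℝ) : Prop :=
  ∀ k, condEntropy (S.law μ) (fun ω => S.F ω (S.D ω k))
    (fun ω => (S.allX ω, S.Z k ω, S.D ω k)) ≤ B * ε

/-- Privacy against colluding users:
`I(D ; X, (Z_k : k ∈ T) | (D_k : k ∈ T)) = 0` for every nonempty set `T` of users. -/
def PrivateAgainstCollusion (μ : Demand K N → ℝ) : Prop :=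
  ∀ T : Finset (Fin K), T.Nonempty →
    condMutualInfo (S.law μ) S.D
      (fun ω => (S.allX ω, fun k : T => S.Z k ω))
      (fun ω => fun k : T => S.D ω k) = 0

/-- Load constraint `∑ k, H(X_k) ≤ B (R + ε)`. -/
def Load (μ : Demand K N → ℝ) (R ε : ℝ) : Prop :=
  ∑ k, entropy (S.law μ) (S.X k) ≤ B * (R + ε)

end Scheme

/-- The load `R` is achievable with cache size `M`, uncoded cache placement and privacy against
colluding users, when the demand vector has law `μ`. -/
def Achievable (K N : ℕ) (μ : Demand K N → ℝ) (M R : ℝ) : Prop :=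
  ∃ ε : ℕ → ℝ, (∀ B, 0 ≤ ε B) ∧ Tendsto ε atTop (𝓝 0) ∧
    ∀ᶠ B : ℕ in atTop, ∃ S : Scheme K N B,
      S.Uncoded ∧ S.CacheSize μ M (ε B) ∧ S.Encoding μ ∧ S.Decoding μ (ε B) ∧
        S.PrivateAgainstCollusion μ ∧ S.Load μ R (ε B)

/-- The optimal load `R*_{u,c}(M)` under uncoded cache placement and user collusion. -/
noncomputable def optimalLoad (K N : ℕ) (μ : Demand K N → ℝ) (M : ℝ) : ℝ :=
  sInf {R : ℝ | Achievable K N μ M R}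

/-- The value at `x` of the lower convex envelope of a set of points of the plane. -/
noncomputable def lowerConvexEnvelope (s : Set (ℝ × ℝ)) (x : ℝ) : ℝ :=
  sInf {y : ℝ | (x, y) ∈ convexHull ℝ s}

/-- The memory-load pairs of Scheme A: with `U = (K - 1) N`, the points
`((N + t - 1) / K, (choose U t - choose (U - N) t) / choose U (t - 1))` for `1 ≤ t ≤ U + 1`. -/
def schemeAPoints (K N : ℕ) : Set (ℝ × ℝ) :=
  {p | ∃ t : ℕ, 1 ≤ t ∧ t ≤ (K - 1) * N + 1 ∧
    p = (((N : ℝ) + t - 1) / K,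
      ((((K - 1) * N).choose t : ℝ) - (((K - 1) * N - N).choose t : ℝ)) /
        (((K - 1) * N).choose (t - 1) : ℝ))}

/-- The load of Scheme A at cache size `M`: the lower convex envelope of its memory-load pairs. -/
noncomputable def schemeALoad (K N : ℕ) (M : ℝ) : ℝ :=
  lowerConvexEnvelope (schemeAPoints K N) M

end D2DCaching

/-! Write `U = (K - 1) N` and `x = K M - N`. Achievability: every user is given `N` virtual copies
and secretly plays a uniformly random one, `c k`. For each sender `j`, every file has a share cut
into pieces indexed by sets of the `U` copies of the other users. The server announces only the
shifts `s k = d k - c k`, and copy `m` of user `k` is deemed to demand file `s k + m`. The copy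
really played then demands `d k`, while the shifts are uniform whatever the demands are, even to
colluding users (`virtualUserScheme_private`). The copies of any one user demand each file exactly
once, so they serve as leaders: multicast messages for sets missing them are linear combinations of
the others (`multicast_eq_zero`). Counting messages gives the corner loads, and splitting the files
gives the convex envelope. Converse: let all users but `k` collude. What they see does not depend on
the demand of `k` (`prob_metaExcept_eq`), so for the same packets and the same caches of the others
there is, for each file, a possible cache of user `k` that decodes it. Decoding `n` files in
succession, each with its own hypothetical cache, forces the other users' packets to contain all
bits of these files held by the others, minus the overlaps with the hypothetical caches
(`sum_mean_le_of_private`). Averaging over windows of files and summing over `k` leaves the number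
of cached bits, which is almost `N B`, the total cache size, and the total overlap. As placement is
uncoded, overlaps are counted bit by bit and are at most twice the excess of the total cache size
over the number of cached bits (`sum_card_overlap_le`). The outcome is `n (U - n x) ≤ U R` for `1 ≤
n ≤ N` (`Achievable.le_load`). Comparison (`schemeALoad_le_mul`): the load of the scheme is at most
`N`, and at most `(U - x) / x` when `x > 0`. Taking `n = N`, `n = 1` or `n` near `U / (2 x)` gives
ratios at most 2, 4 and 8 in the three regimes, so 18 leaves room. -/

namespace FiniteEntropy

/-! ### Shannon inequalities on finite probability spaces. -/

variable {Ω α β γ δ : Type*} [Fintype Ω] {w : Ω → ℝ}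

open Classical in
lemma prob_eq_sum_ite (w : Ω → ℝ) (X : Ω → α) (x : α) :
    prob w X x = ∑ ω, if X ω = x then w ω else 0 := by
  rw [prob, Finset.sum_filter]

lemma prob_nonneg (hw : ∀ ω, 0 ≤ w ω) (X : Ω → α) (x : α) : 0 ≤ prob w X x :=
  Finset.sum_nonneg fun ω _ => hw ω

lemma le_prob (hw : ∀ ω, 0 ≤ w ω) (X : Ω → α) (ω : Ω) : w ω ≤ prob w X (X ω) := by
  classical
  exact Finset.single_le_sum (f := w) (fun ω _ => hw ω) (by simp)

lemma prob_pos (hw : ∀ ω, 0 ≤ w ω) (X : Ω → α) {ω : Ω} (h : w ω ≠ 0) : 0 < prob w X (X ω) :=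
  lt_of_lt_of_le (lt_of_le_of_ne (hw ω) h.symm) (le_prob hw X ω)

lemma prob_mono (hw : ∀ ω, 0 ≤ w ω) {X : Ω → α} {Y : Ω → β} {x : α} {y : β}
    (h : ∀ ω, X ω = x → Y ω = y) : prob w X x ≤ prob w Y y := by
  classical
  rw [prob_eq_sum_ite, prob_eq_sum_ite]
  refine Finset.sum_le_sum fun ω _ => ?_
  by_cases hx : X ω = x
  · simp [hx, h ω hx]
  · simp only [hx, if_false]
    split_ifs
    exacts [hw ω, le_rfl]

lemma prob_eq_zero_of_notMem {X : Ω → α} {x : α} (h : ∀ ω, X ω ≠ x) : prob w X x = 0 := by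
  classical
  rw [prob_eq_sum_ite]
  exact Finset.sum_eq_zero fun ω _ => by simp [h ω]

/-- Transfer of an expectation to the values of a random variable. -/
lemma sum_mul_comp [DecidableEq α] (w : Ω → ℝ) (X : Ω → α) {s : Finset α}
    (hs : ∀ ω, X ω ∈ s) (φ : α → ℝ) :
    ∑ ω, w ω * φ (X ω) = ∑ x ∈ s, prob w X x * φ x := by
  simp only [prob_eq_sum_ite, Finset.sum_mul]
  rw [Finset.sum_comm]
  refine Finset.sum_congr rfl fun ω _ => ?_
  simp [ite_mul, hs ω]

lemma entropy_eq_sum (w : Ω → ℝ) (X : Ω → α) :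
    entropy w X = ∑ ω, w ω * -Real.logb 2 (prob w X (X ω)) := by
  classical
  rw [sum_mul_comp w X (s := univ.image X) (fun ω => by simp)
    (fun x => -Real.logb 2 (prob w X x)), entropy]
  refine Finset.sum_congr (by ext; simp) fun x _ => by ring

lemma sum_prob [DecidableEq α] (w : Ω → ℝ) (X : Ω → α) {s : Finset α}
    (hs : ∀ ω, X ω ∈ s) : ∑ x ∈ s, prob w X x = ∑ ω, w ω := by
  have := sum_mul_comp w X hs (fun _ => 1)
  simpa using this.symm

/-- Marginalization. -/
lemma sum_prob_prodMk [DecidableEq α] (w : Ω → ℝ) (X : Ω → α) (Z : Ω → γ) {s : Finset α}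
    (hs : ∀ ω, X ω ∈ s) (z : γ) :
    ∑ x ∈ s, prob w (fun ω => (X ω, Z ω)) (x, z) = prob w Z z := by
  classical
  simp only [prob_eq_sum_ite]
  rw [Finset.sum_comm]
  refine Finset.sum_congr rfl fun ω _ => ?_
  by_cases hz : Z ω = z
  · simp [hz, hs ω]
  · simp [hz]

/-- The correction `a - b` sums to zero for two families of equal mass, which turns a divergence
into a sum of nonnegative terms. -/
lemma kl_term {a b : ℝ} (h : b = 0 → a = 0) :
    a * Real.log (a / b) - (a - b) = b * InformationTheory.klFun (a / b) := by
  by_cases hb : b = 0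
  · simp [hb, h hb]
  · rw [InformationTheory.klFun_apply]; field_simp; ring

/-- Gibbs' inequality. -/
lemma gibbs_nonneg {ι : Type*} {s : Finset ι} {a b : ι → ℝ} (ha : ∀ i ∈ s, 0 ≤ a i)
    (hb : ∀ i ∈ s, 0 ≤ b i) (hab : ∀ i ∈ s, b i = 0 → a i = 0)
    (hsum : ∑ i ∈ s, a i = ∑ i ∈ s, b i) :
    0 ≤ ∑ i ∈ s, a i * Real.logb 2 (a i / b i) := by
  have h1 : ∑ i ∈ s, a i * Real.log (a i / b i) =
      ∑ i ∈ s, b i * InformationTheory.klFun (a i / b i) := by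
    rw [← sub_zero (∑ i ∈ s, a i * Real.log (a i / b i)), ← sub_self (∑ i ∈ s, a i)]
    nth_rewrite 2 [hsum]
    rw [← Finset.sum_sub_distrib, ← Finset.sum_sub_distrib]
    exact Finset.sum_congr rfl fun i hi => kl_term (hab i hi)
  simp only [Real.logb, ← mul_div_assoc]
  rw [← Finset.sum_div, h1]
  refine div_nonneg (Finset.sum_nonneg fun i hi => mul_nonneg (hb i hi) ?_)
    (Real.log_nonneg (by norm_num))
  exact InformationTheory.klFun_nonneg (div_nonneg (ha i hi) (hb i hi))

/-- Equality case of Gibbs' inequality: every term `b i * klFun (a i / b i)` must vanish, and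
`klFun` vanishes only at 1. -/
lemma eq_of_gibbs_eq_zero {ι : Type*} {s : Finset ι} {a b : ι → ℝ} (ha : ∀ i ∈ s, 0 ≤ a i)
    (hb : ∀ i ∈ s, 0 ≤ b i) (hab : ∀ i ∈ s, b i = 0 → a i = 0)
    (hsum : ∑ i ∈ s, a i = ∑ i ∈ s, b i)
    (h0 : ∑ i ∈ s, a i * Real.logb 2 (a i / b i) = 0) : ∀ i ∈ s, a i = b i := by
  have h1 : ∑ i ∈ s, a i * Real.log (a i / b i) =
      ∑ i ∈ s, b i * InformationTheory.klFun (a i / b i) := by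
    rw [← sub_zero (∑ i ∈ s, a i * Real.log (a i / b i)), ← sub_self (∑ i ∈ s, a i)]
    nth_rewrite 2 [hsum]
    rw [← Finset.sum_sub_distrib, ← Finset.sum_sub_distrib]
    exact Finset.sum_congr rfl fun i hi => kl_term (hab i hi)
  simp only [Real.logb, ← mul_div_assoc] at h0
  rw [← Finset.sum_div, div_eq_zero_iff, h1] at h0
  have h2 := h0.resolve_right (Real.log_pos (by norm_num)).ne'
  rw [Finset.sum_eq_zero_iff_of_nonneg fun i hi => mul_nonneg (hb i hi)
    (InformationTheory.klFun_nonneg (div_nonneg (ha i hi) (hb i hi)))] at h2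
  intro i hi
  by_cases hbi : b i = 0
  · rw [hbi, hab i hi hbi]
  · have h3 := (mul_eq_zero.1 (h2 i hi)).resolve_left hbi
    rw [InformationTheory.klFun_eq_zero_iff (div_nonneg (ha i hi) (hb i hi))] at h3
    rwa [div_eq_one_iff_eq hbi] at h3

/-- Entropy sees a variable only through the partition of the support into its fibres. -/
lemma entropy_congr {X : Ω → α} {Y : Ω → β}
    (h : ∀ ω ω', w ω ≠ 0 → w ω' ≠ 0 → (X ω = X ω' ↔ Y ω = Y ω')) :
    entropy w X = entropy w Y := by
  classical
  rw [entropy_eq_sum, entropy_eq_sum]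
  refine Finset.sum_congr rfl fun ω _ => ?_
  by_cases hω : w ω = 0
  · simp [hω]
  · have : prob w X (X ω) = prob w Y (Y ω) := by
      rw [prob_eq_sum_ite, prob_eq_sum_ite]
      refine Finset.sum_congr rfl fun ω' _ => ?_
      by_cases hω' : w ω' = 0
      · simp [hω']
      · simp only [h ω' ω hω' hω]
    rw [this]

lemma entropy_mono (hw : ∀ ω, 0 ≤ w ω) {X : Ω → α} {Y : Ω → β}
    (h : ∀ ω ω', Y ω = Y ω' → X ω = X ω') : entropy w X ≤ entropy w Y := by
  rw [entropy_eq_sum, entropy_eq_sum]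
  refine Finset.sum_le_sum fun ω _ => ?_
  by_cases hω : w ω = 0
  · simp [hω]
  · refine mul_le_mul_of_nonneg_left (neg_le_neg ?_) (hw ω)
    exact Real.logb_le_logb_of_le (by norm_num) (prob_pos hw Y hω)
      (prob_mono hw fun ω' hω' => h _ _ hω')

lemma condEntropy_nonneg (hw : ∀ ω, 0 ≤ w ω) (X : Ω → α) (Y : Ω → β) :
    0 ≤ condEntropy w X Y :=
  sub_nonneg.2 (entropy_mono hw fun _ _ h => (Prod.ext_iff.1 h).2)

section CondMutualInfo

variable (w) (X : Ω → α) (Y : Ω → β) (Z : Ω → γ)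

lemma condMutualInfo_eq_sum (hw : ∀ ω, 0 ≤ w ω) : condMutualInfo w X Y Z = ∑ ω, w ω *
    Real.logb 2 (prob w (fun ω => (X ω, Y ω, Z ω)) (X ω, Y ω, Z ω) /
      (prob w (fun ω => (X ω, Z ω)) (X ω, Z ω) * prob w (fun ω => (Y ω, Z ω)) (Y ω, Z ω) /
        prob w Z (Z ω))) := by
  simp only [condMutualInfo, condEntropy, entropy_eq_sum]
  rw [← Finset.sum_sub_distrib, ← Finset.sum_sub_distrib, ← Finset.sum_sub_distrib]
  refine Finset.sum_congr rfl fun ω _ => ?_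
  by_cases hω : w ω = 0
  · simp [hω]
  have h1 := (prob_pos hw (fun ω => (X ω, Y ω, Z ω)) hω).ne'
  have h2 := (prob_pos hw (fun ω => (X ω, Z ω)) hω).ne'
  have h3 := (prob_pos hw (fun ω => (Y ω, Z ω)) hω).ne'
  have h4 := (prob_pos hw Z hω).ne'
  rw [Real.logb_div h1 (div_ne_zero (mul_ne_zero h2 h3) h4),
    Real.logb_div (mul_ne_zero h2 h3) h4, Real.logb_mul h2 h3]
  ring

/-- Conditional mutual information is the divergence of the joint law from the law that makes `X`
and `Y` conditionally independent given `Z`; the equality case of Gibbs identifies the two laws. -/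
lemma condMutualInfo_gibbs (hw : ∀ ω, 0 ≤ w ω) :
    0 ≤ condMutualInfo w X Y Z ∧ (condMutualInfo w X Y Z = 0 → ∀ x y z,
      prob w (fun ω => (X ω, Y ω, Z ω)) (x, y, z) * prob w Z z =
        prob w (fun ω => (X ω, Z ω)) (x, z) * prob w (fun ω => (Y ω, Z ω)) (y, z)) := by
  classical
  set s : Finset (α × β × γ) := univ.image X ×ˢ univ.image Y ×ˢ univ.image Z with hs
  set a : α × β × γ → ℝ := fun t => prob w (fun ω => (X ω, Y ω, Z ω)) t with ha
  set b : α × β × γ → ℝ := fun t => prob w (fun ω => (X ω, Z ω)) (t.1, t.2.2) *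
    prob w (fun ω => (Y ω, Z ω)) t.2 / prob w Z t.2.2 with hb
  have hI : condMutualInfo w X Y Z = ∑ t ∈ s, a t * Real.logb 2 (a t / b t) := by
    rw [condMutualInfo_eq_sum w X Y Z hw]
    exact sum_mul_comp w (fun ω => (X ω, Y ω, Z ω)) (s := s) (fun ω => by simp [hs])
      (fun t => Real.logb 2 (a t / b t))
  have ha0 : ∀ t ∈ s, 0 ≤ a t := fun t _ => prob_nonneg hw _ _
  have hb0 : ∀ t ∈ s, 0 ≤ b t := fun t _ =>
    div_nonneg (mul_nonneg (prob_nonneg hw _ _) (prob_nonneg hw _ _)) (prob_nonneg hw _ _)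
  have hab : ∀ t, b t = 0 → a t = 0 := by
    rintro ⟨x, y, z⟩ h
    have h1 : a (x, y, z) ≤ prob w (fun ω => (X ω, Z ω)) (x, z) :=
      prob_mono hw fun ω hω => by simp_all
    have h2 : a (x, y, z) ≤ prob w (fun ω => (Y ω, Z ω)) (y, z) :=
      prob_mono hw fun ω hω => by simp_all
    have h3 : a (x, y, z) ≤ prob w Z z := prob_mono hw fun ω hω => by simp_all
    have h0 : 0 ≤ a (x, y, z) := prob_nonneg hw _ _
    simp only [hb, div_eq_zero_iff, mul_eq_zero] at h
    rcases h with (h | h) | h <;> linarith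
  -- For each `z`, summing `b` over `x` and `y` gives `p(z) p(z) / p(z) = p(z)`.
  have hsum : ∑ t ∈ s, a t = ∑ t ∈ s, b t := by
    rw [sum_prob w _ (fun ω => by simp [hs]), hs, Finset.sum_product_right]
    simp only [hb]
    rw [Finset.sum_product_right]
    rw [← sum_prob w Z (s := univ.image Z) (fun ω => by simp)]
    refine Finset.sum_congr rfl fun z _ => ?_
    simp only [← Finset.sum_div, ← Finset.sum_mul]
    rw [sum_prob_prodMk w X Z (fun ω => by simp), ← Finset.mul_sum,
      sum_prob_prodMk w Y Z (fun ω => by simp)]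
    by_cases hz : prob w Z z = 0
    · simp [hz]
    · field_simp
  refine ⟨hI ▸ gibbs_nonneg ha0 hb0 (fun t _ => hab t) hsum, fun h0 x y z => ?_⟩
  rw [hI] at h0
  have key := eq_of_gibbs_eq_zero ha0 hb0 (fun t _ => hab t) hsum h0
  by_cases hz : prob w Z z = 0
  · rw [hz, mul_zero]
    have h1 : prob w (fun ω => (X ω, Z ω)) (x, z) ≤ prob w Z z :=
      prob_mono hw fun ω hω => by simp_all
    have h2 := prob_nonneg hw (fun ω => (X ω, Z ω)) (x, z)
    rw [le_antisymm (h1.trans hz.le) h2, zero_mul]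
  suffices h : a (x, y, z) = b (x, y, z) by
    simp only [ha, hb] at h
    rw [h, div_mul_cancel₀ _ hz]
  by_cases hm : (x, y, z) ∈ s
  · exact key _ hm
  · have : b (x, y, z) = 0 := by
      simp only [hs, mem_product, mem_image, mem_univ, true_and, not_and_or, not_exists] at hm
      simp only [hb, div_eq_zero_iff, mul_eq_zero]
      rcases hm with h | h | h
      · exact .inl (.inl (prob_eq_zero_of_notMem fun ω hω => h ω (by simp_all)))
      · exact .inl (.inr (prob_eq_zero_of_notMem fun ω hω => h ω (by simp_all)))
      · exact .inr (prob_eq_zero_of_notMem fun ω hω => h ω (by simp_all))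
    rw [this, hab _ this]

end CondMutualInfo

lemma condMutualInfo_nonneg (hw : ∀ ω, 0 ≤ w ω) (X : Ω → α) (Y : Ω → β) (Z : Ω → γ) :
    0 ≤ condMutualInfo w X Y Z :=
  (condMutualInfo_gibbs w X Y Z hw).1

lemma condMutualInfo_eq_zero {X : Ω → α} {Y : Ω → β} {Z : Ω → γ} (hw : ∀ ω, 0 ≤ w ω)
    (h : ∀ ω, w ω ≠ 0 →
      prob w (fun ω => (X ω, Y ω, Z ω)) (X ω, Y ω, Z ω) * prob w Z (Z ω) =
        prob w (fun ω => (X ω, Z ω)) (X ω, Z ω) * prob w (fun ω => (Y ω, Z ω)) (Y ω, Z ω)) :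
    condMutualInfo w X Y Z = 0 := by
  rw [condMutualInfo_eq_sum w X Y Z hw]
  refine Finset.sum_eq_zero fun ω _ => ?_
  by_cases hω : w ω = 0
  · simp [hω]
  have h1 := (prob_pos hw (fun ω => (X ω, Y ω, Z ω)) hω).ne'
  have h4 := (prob_pos hw Z hω).ne'
  rw [← h ω hω, mul_div_cancel_right₀ _ h4, div_self h1]
  simp

/-- Conditioning on less increases entropy. -/
lemma condEntropy_anti (hw : ∀ ω, 0 ≤ w ω) (X : Ω → α) {Y : Ω → β} {Z : Ω → γ}
    (h : ∀ ω ω', Y ω = Y ω' → Z ω = Z ω') : condEntropy w X Y ≤ condEntropy w X Z := by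
  have h1 := condMutualInfo_nonneg hw X Y Z
  have h2 : condEntropy w X (fun ω => (Y ω, Z ω)) = condEntropy w X Y := by
    rw [condEntropy, condEntropy]
    congr 1 <;> refine entropy_congr fun ω ω' _ _ => ?_
    · simp only [Prod.mk.injEq]; exact ⟨fun H => ⟨H.1, H.2.1⟩, fun H => ⟨H.1, H.2, h _ _ H.2⟩⟩
    · simp only [Prod.mk.injEq]; exact ⟨fun H => H.1, fun H => ⟨H, h _ _ H⟩⟩
  rw [condMutualInfo, h2] at h1
  linarith

/-- The chain rule. -/
lemma condEntropy_prodMk (w : Ω → ℝ) (X : Ω → α) (X' : Ω → δ) (Y : Ω → β) :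
    condEntropy w (fun ω => (X ω, X' ω)) Y =
      condEntropy w X' Y + condEntropy w X (fun ω => (X' ω, Y ω)) := by
  have : entropy w (fun ω => ((X ω, X' ω), Y ω)) = entropy w (fun ω => (X ω, X' ω, Y ω)) :=
    entropy_congr fun ω ω' _ _ => by simp [and_assoc]
  simp only [condEntropy, this]
  ring

lemma condEntropy_eq_zero {X : Ω → α} {Y : Ω → β}
    (h : ∀ ω ω', w ω ≠ 0 → w ω' ≠ 0 → Y ω = Y ω' → X ω = X ω') : condEntropy w X Y = 0 := by
  rw [condEntropy, sub_eq_zero]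
  refine entropy_congr fun ω ω' h1 h2 => ?_
  simp only [Prod.mk.injEq]
  exact ⟨fun H => H.2, fun H => ⟨h _ _ h1 h2 H, H⟩⟩

lemma entropy_const (hw1 : ∑ ω, w ω = 1) (c : α) : entropy w (fun _ => c) = 0 := by
  classical
  rw [entropy_eq_sum]
  refine Finset.sum_eq_zero fun ω _ => ?_
  simp [prob, hw1]

lemma condEntropy_le_entropy (hw : ∀ ω, 0 ≤ w ω) (hw1 : ∑ ω, w ω = 1) (X : Ω → α) (Y : Ω → β) :
    condEntropy w X Y ≤ entropy w X := by
  refine (condEntropy_anti hw X (Z := fun _ => ()) fun _ _ _ => rfl).trans ?_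
  rw [condEntropy, entropy_const hw1, sub_zero]
  exact entropy_mono hw fun ω ω' h => by simp [h]

/-- Entropy is subadditive. -/
lemma entropy_pi_le {ι : Type*} (hw : ∀ ω, 0 ≤ w ω) (hw1 : ∑ ω, w ω = 1) {A : ι → Type*}
    (X : ∀ i, Ω → A i) (s : Finset ι) :
    entropy w (fun ω => fun i : s => X i ω) ≤ ∑ i ∈ s, entropy w (X i) := by
  classical
  induction s using Finset.induction_on with
  | empty =>
    rw [Finset.sum_empty, ← entropy_const hw1 ()]
    exact entropy_mono hw fun ω ω' _ => by ext i; exact absurd i.2 (Finset.notMem_empty _)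
  | insert i s hi ih =>
    rw [Finset.sum_insert hi]
    have h1 := condEntropy_le_entropy hw hw1 (X i) (fun ω => fun j : s => X j ω)
    rw [condEntropy] at h1
    refine (entropy_mono hw (Y := fun ω => (X i ω, fun j : s => X j ω)) ?_).trans
      (by linarith)
    intro ω ω' h
    simp only [Prod.mk.injEq] at h
    funext ⟨j, hj⟩
    rcases Finset.mem_insert.1 hj with rfl | hj'
    · exact h.1
    · exact congrFun h.2 ⟨j, hj'⟩

lemma entropy_le_logb_card {T : Type*} [Fintype T] (hw : ∀ ω, 0 ≤ w ω) (hw1 : ∑ ω, w ω = 1)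
    {X : Ω → α} (g : Ω → T) (h : ∀ ω ω', g ω = g ω' → X ω = X ω') :
    entropy w X ≤ Real.logb 2 (Fintype.card T) := by
  classical
  refine (entropy_mono hw h).trans ?_
  have hne : Nonempty Ω := by
    by_contra hne
    rw [not_nonempty_iff] at hne
    simp at hw1
  have hT : (0 : ℝ) < Fintype.card T := by
    have : Nonempty T := ⟨g hne.some⟩
    exact_mod_cast Fintype.card_pos
  have hs : ∑ x, prob w g x = ∑ ω, w ω := sum_prob w g fun ω => mem_univ _
  -- Gibbs' inequality against the uniform law on `T`.
  have key := gibbs_nonneg (s := (univ : Finset T)) (a := prob w g)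
    (b := fun _ => 1 / (Fintype.card T : ℝ)) (fun t _ => prob_nonneg hw _ _)
    (fun _ _ => by positivity) (fun _ _ h => absurd h (by positivity))
    (by rw [hs, hw1]; simp [hT.ne'])
  have h2 : ∑ t, prob w g t * Real.logb 2 (prob w g t / (1 / (Fintype.card T : ℝ))) =
      -entropy w g + Real.logb 2 (Fintype.card T) := by
    have : ∀ t, prob w g t * Real.logb 2 (prob w g t / (1 / (Fintype.card T : ℝ))) =
        -(prob w g t * -Real.logb 2 (prob w g t)) +
          prob w g t * Real.logb 2 (Fintype.card T) := by
      intro t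
      by_cases ht : prob w g t = 0
      · simp [ht]
      · rw [div_div_eq_mul_div, div_one, Real.logb_mul ht hT.ne']; ring
    simp only [this]
    rw [Finset.sum_add_distrib, Finset.sum_neg_distrib, ← Finset.sum_mul, hs, hw1, one_mul,
      entropy_eq_sum, sum_mul_comp w g (fun ω => mem_univ _) fun t => -Real.logb 2 (prob w g t)]
  rw [h2] at key
  linarith

/-! ### Conditioning on one factor of a product law. -/

section Slice

variable {S L : Type*} [Fintype S] [Fintype L] (e : S × L ≃ Ω) {ρ : S → ℝ} {u : L → ℝ}

/-- For a product law, the entropy given the first component is the average of the entropies of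
the sections. -/
lemma condEntropy_fst_eq_sum (hu : ∀ l, 0 ≤ u l) (hu1 : ∑ l, u l = 1)
    (hw : ∀ m l, w (e (m, l)) = ρ m * u l) (X : Ω → α) :
    condEntropy w X (fun ω => (e.symm ω).1) = ∑ m, ρ m * entropy u (fun l => X (e (m, l))) := by
  classical
  simp only [condEntropy, entropy_eq_sum]
  rw [← Finset.sum_sub_distrib, ← e.sum_comp, Fintype.sum_prod_type]
  refine Finset.sum_congr rfl fun m _ => ?_
  rw [Finset.mul_sum]
  refine Finset.sum_congr rfl fun l _ => ?_
  have h1 : prob w (fun ω => (e.symm ω).1) m = ρ m := by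
    rw [prob_eq_sum_ite, ← e.sum_comp, Fintype.sum_prod_type]
    simp only [Equiv.symm_apply_apply, hw]
    rw [Finset.sum_eq_single m (fun m' _ h => by simp [h]) (by simp)]
    simp [← Finset.mul_sum, hu1]
  have h2 : prob w (fun ω => (X ω, (e.symm ω).1)) (X (e (m, l)), m) =
      ρ m * prob u (fun l => X (e (m, l))) (X (e (m, l))) := by
    rw [prob_eq_sum_ite, ← e.sum_comp, Fintype.sum_prod_type]
    simp only [Equiv.symm_apply_apply, hw, Prod.mk.injEq]
    rw [Finset.sum_eq_single m (fun m' _ h => by simp [h]) (by simp), prob_eq_sum_ite,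
      Finset.mul_sum]
    simp
  simp only [Equiv.symm_apply_apply, h1, h2, hw]
  by_cases hm : ρ m = 0
  · simp [hm]
  by_cases hl : u l = 0
  · simp [hl]
  rw [Real.logb_mul hm (prob_pos hu (fun l => X (e (m, l))) hl).ne']
  ring

lemma condEntropy_prodMk_fst_eq_sum (hu : ∀ l, 0 ≤ u l) (hu1 : ∑ l, u l = 1)
    (hw : ∀ m l, w (e (m, l)) = ρ m * u l) (X : Ω → α) (Y : Ω → β) :
    condEntropy w X (fun ω => (Y ω, (e.symm ω).1)) =
      ∑ m, ρ m * condEntropy u (fun l => X (e (m, l))) (fun l => Y (e (m, l))) := by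
  have h := condEntropy_prodMk w X Y (fun ω => (e.symm ω).1)
  rw [condEntropy_fst_eq_sum e hu hu1 hw, condEntropy_fst_eq_sum e hu hu1 hw] at h
  rw [← sub_eq_iff_eq_add'] at h
  rw [← h, ← Finset.sum_sub_distrib]
  exact Finset.sum_congr rfl fun m _ => by rw [condEntropy]; ring

end Slice

end FiniteEntropy

/-! ### Vanishing conditional entropy, and averaging over laws with a common marginal. -/

namespace FiniteEntropy

variable {Ω α β γ δ : Type*} [Fintype Ω] {w : Ω → ℝ}

lemma condEntropy_congr {X : Ω → α} {Y : Ω → β} {X' : Ω → γ} {Y' : Ω → δ}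
    (hY : ∀ ω ω', Y ω = Y ω' ↔ Y' ω = Y' ω')
    (hX : ∀ ω ω', Y ω = Y ω' → (X ω = X ω' ↔ X' ω = X' ω')) :
    condEntropy w X Y = condEntropy w X' Y' := by
  rw [condEntropy, condEntropy]
  congr 1
  · refine entropy_congr fun ω ω' _ _ => ?_
    simp only [Prod.mk.injEq, ← hY]
    exact ⟨fun H => ⟨(hX _ _ H.2).1 H.1, H.2⟩, fun H => ⟨(hX _ _ H.2).2 H.1, H.2⟩⟩
  · exact entropy_congr fun ω ω' _ _ => hY ω ω'

/-- `H(X, Y) - H(Y)` is a sum of nonnegative terms comparing the mass of a fibre of `(X, Y)` with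
that of the fibre of `Y` around it. If all vanish, no mass is left for another value of `X` in that
fibre. -/
lemma eq_of_condEntropy_eq_zero (hw : ∀ ω, 0 ≤ w ω) {X : Ω → α} {Y : Ω → β}
    (h : condEntropy w X Y = 0) {ω ω' : Ω} (hω : w ω ≠ 0) (hω' : w ω' ≠ 0)
    (hY : Y ω = Y ω') : X ω = X ω' := by
  classical
  rw [condEntropy, entropy_eq_sum, entropy_eq_sum, ← Finset.sum_sub_distrib,
    Finset.sum_eq_zero_iff_of_nonneg] at h
  · have h1 := h ω (mem_univ _)
    rw [← mul_sub, mul_eq_zero, sub_eq_zero, neg_inj] at h1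
    have h2 := (Real.logb_injOn_pos (by norm_num : (1 : ℝ) < 2)) (prob_pos hw _ hω)
      (prob_pos hw _ hω) (h1.resolve_left hω)
    by_contra hX
    rw [prob_eq_sum_ite, prob_eq_sum_ite] at h2
    refine (Finset.sum_lt_sum (fun ω'' _ => ?_) ⟨ω', mem_univ _, ?_⟩).ne h2
    · by_cases hc : Y ω'' = Y ω
      · simp only [Prod.mk.injEq, hc, and_true, if_true]
        split_ifs
        exacts [le_rfl, hw _]
      · simp [hc]
    · simp only [Prod.mk.injEq, hY, and_true, if_true, Ne.symm hX, if_false]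
      exact lt_of_le_of_ne (hw _) hω'.symm
  · intro ω'' _
    rw [← mul_sub]
    by_cases h0 : w ω'' = 0
    · simp [h0]
    refine mul_nonneg (hw _) (sub_nonneg.2 (neg_le_neg ?_))
    refine Real.logb_le_logb_of_le (by norm_num) (prob_pos hw _ h0) (prob_mono hw fun ω hω => ?_)
    exact (Prod.ext_iff.1 hω).2

/-- If the conditional mutual information given `Z` of `X` and `Y` vanishes, then so does that of
`X` and any function of `Y`. -/
lemma condMutualInfo_comp_eq_zero (hw : ∀ ω, 0 ≤ w ω) {X : Ω → α} {Y : Ω → β} {Z : Ω → γ}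
    {Y' : Ω → δ} (hY : ∀ ω ω', Y ω = Y ω' → Y' ω = Y' ω') (h : condMutualInfo w X Y Z = 0) :
    condMutualInfo w X Y' Z = 0 := by
  refine le_antisymm ?_ (condMutualInfo_nonneg hw X Y' Z)
  rw [← h]
  refine sub_le_sub_left (condEntropy_anti hw X fun ω ω' H => ?_) _
  simp only [Prod.mk.injEq] at H ⊢
  exact ⟨hY _ _ H.1, H.2⟩

/-- Several laws `ν r` with the same law `ν₀` of `g`: a lower bound on `H` which holds for all
selections from a fibre of `g` holds on average. -/
lemma sum_le_of_forall_selection {Ξ W : Type*} [Fintype Ξ] (g : Ξ → W) (n : ℕ)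
    {ν : ℕ → Ξ → ℝ} {ν₀ : Ξ → ℝ} (hν : ∀ r ξ, 0 ≤ ν r ξ) (hν₀ : ∀ ξ, 0 ≤ ν₀ ξ)
    (hmarg : ∀ r < n, ∀ ξ, prob (ν r) g (g ξ) = prob ν₀ g (g ξ)) (H : Ξ → ℝ) (T : ℕ → Ξ → ℝ)
    (h : ∀ ξ₀, ν₀ ξ₀ ≠ 0 → ∀ sel : ℕ → Ξ,
      (∀ r < n, g (sel r) = g ξ₀ ∧ ν r (sel r) ≠ 0) → ∑ r ∈ range n, T r (sel r) ≤ H ξ₀) :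
    ∑ r ∈ range n, ∑ ξ, ν r ξ * T r ξ ≤ ∑ ξ, ν₀ ξ * H ξ := by
  classical
  have hfib : ∀ φ : Ξ → ℝ, ∑ ξ, φ ξ = ∑ x ∈ univ.image g, ∑ ξ with g ξ = x, φ ξ := fun φ =>
    (Finset.sum_fiberwise_of_maps_to (fun ξ _ => by simp) _).symm
  simp only [hfib]
  rw [Finset.sum_comm]
  refine Finset.sum_le_sum fun x hx => ?_
  obtain ⟨ξ₁, -, rfl⟩ := Finset.mem_image.1 hx
  have hp : ∀ r < n, ∑ ξ with g ξ = g ξ₁, ν r ξ = ∑ ξ with g ξ = g ξ₁, ν₀ ξ := by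
    intro r hr
    have := hmarg r hr ξ₁
    simpa only [prob_eq_sum_ite, ← Finset.sum_filter] using this
  set η := ∑ ξ with g ξ = g ξ₁, ν₀ ξ with hη
  by_cases h0 : η = 0
  · have hz : ∀ r < n, ∀ ξ, g ξ = g ξ₁ → ν r ξ = 0 := by
      intro r hr ξ hξ
      have h1 := hp r hr
      rw [h0, Finset.sum_eq_zero_iff_of_nonneg fun _ _ => hν _ _] at h1
      exact h1 ξ (by simp [hξ])
    have hz0 : ∀ ξ, g ξ = g ξ₁ → ν₀ ξ = 0 := by
      intro ξ hξ
      have h1 := hη.symm.trans h0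
      rw [Finset.sum_eq_zero_iff_of_nonneg fun _ _ => hν₀ _] at h1
      exact h1 ξ (by simp [hξ])
    rw [Finset.sum_eq_zero fun r hr => Finset.sum_eq_zero fun ξ hξ => by
      rw [hz r (mem_range.1 hr) ξ (mem_filter.1 hξ).2, zero_mul],
      Finset.sum_eq_zero fun ξ hξ => by rw [hz0 ξ (mem_filter.1 hξ).2, zero_mul]]
  have hηpos : 0 < η := lt_of_le_of_ne (Finset.sum_nonneg fun _ _ => hν₀ _) (Ne.symm h0)
  -- All the laws give the fibre the same mass `η`, and some point charged by `ν r` has `T r` at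
  -- least equal to its average there. Using these points as the selection avoids constructing a
  -- coupling of the laws.
  have hsel : ∀ r < n, ∃ ξ, g ξ = g ξ₁ ∧ ν r ξ ≠ 0 ∧
      ∑ ξ' with g ξ' = g ξ₁, ν r ξ' * T r ξ' ≤ η * T r ξ := by
    intro r hr
    by_contra! hcon
    set c := (∑ ξ' with g ξ' = g ξ₁, ν r ξ' * T r ξ') / η with hc
    have hlt : ∀ ξ, g ξ = g ξ₁ → ν r ξ ≠ 0 → T r ξ < c := fun ξ h1 h2 => by
      rw [hc, lt_div_iff₀ hηpos, mul_comm]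
      exact hcon ξ h1 h2
    have hex : ∃ ξ ∈ univ.filter (fun ξ => g ξ = g ξ₁), ν r ξ ≠ 0 := by
      by_contra! hcon'
      exact h0 ((hp r hr).symm.trans (Finset.sum_eq_zero hcon'))
    have : ∑ ξ' with g ξ' = g ξ₁, ν r ξ' * T r ξ' < ∑ ξ' with g ξ' = g ξ₁, ν r ξ' * c := by
      obtain ⟨ξ, hξ, hne⟩ := hex
      refine Finset.sum_lt_sum (fun ξ' hξ' => ?_) ⟨ξ, hξ, ?_⟩
      · by_cases hz : ν r ξ' = 0
        · simp [hz]
        · exact mul_le_mul_of_nonneg_left (hlt _ (mem_filter.1 hξ').2 hz).le (hν _ _)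
      · exact mul_lt_mul_of_pos_left (hlt _ (mem_filter.1 hξ).2 hne)
          (lt_of_le_of_ne (hν _ _) hne.symm)
    rw [← Finset.sum_mul, hp r hr, hc, mul_div_cancel₀ _ h0] at this
    exact lt_irrefl _ this
  have : Nonempty Ξ := ⟨ξ₁⟩
  choose! sel hs1 hs2 hs3 using hsel
  have hA : ∑ r ∈ range n, ∑ ξ with g ξ = g ξ₁, ν r ξ * T r ξ ≤
      η * ∑ r ∈ range n, T r (sel r) := by
    rw [Finset.mul_sum]
    exact Finset.sum_le_sum fun r hr => hs3 r (mem_range.1 hr)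
  refine hA.trans ?_
  rw [hη, Finset.sum_mul]
  refine Finset.sum_le_sum fun ξ hξ => ?_
  by_cases hz : ν₀ ξ = 0
  · simp [hz]
  · refine mul_le_mul_of_nonneg_left (h ξ hz sel fun r hr => ⟨?_, hs2 r hr⟩) (hν₀ _)
    rw [hs1 r hr, (mem_filter.1 hξ).2]

end FiniteEntropy

/-! ### Entropy of sets of library bits, and successive decoding with metadata fixed. -/

namespace D2DCaching

variable {K N B : ℕ}

/-- The uniform law of the library. -/
noncomputable def libraryLaw (N B : ℕ) (_ : Library N B) : ℝ := (1 / 2 : ℝ) ^ (N * B)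

lemma libraryLaw_nonneg (f : Library N B) : 0 ≤ libraryLaw N B f := by
  unfold libraryLaw; positivity

lemma libraryLaw_ne_zero (f : Library N B) : libraryLaw N B f ≠ 0 := by
  unfold libraryLaw; positivity

lemma sum_libraryLaw : ∑ f, libraryLaw N B f = 1 := by
  simp only [libraryLaw, Finset.sum_const, Finset.card_univ, Fintype.card_pi, Fintype.card_bool,
    Finset.prod_const, Fintype.card_fin, ← pow_mul, nsmul_eq_mul]
  push_cast
  rw [mul_comm B N, ← mul_pow]
  norm_num

/-- The bits of the library at the positions in `A`. -/
def mask (A : Finset (Fin N × Fin B)) (f : Library N B) (p : Fin N × Fin B) : Bool :=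
  if p ∈ A then f p.1 p.2 else false

lemma mask_eq_iff {A : Finset (Fin N × Fin B)} {f f' : Library N B} :
    mask A f = mask A f' ↔ ∀ p ∈ A, f p.1 p.2 = f' p.1 p.2 := by
  constructor
  · intro h p hp
    simpa [mask, hp] using congrFun h p
  · intro h
    funext p
    by_cases hp : p ∈ A <;> simp [mask, hp, h]

lemma prob_mask (A : Finset (Fin N × Fin B)) (f : Library N B) :
    prob (libraryLaw N B) (mask A) (mask A f) = (1 / 2 : ℝ) ^ #A := by
  classical
  have h1 : (univ.filter fun f' : Library N B => mask A f' = mask A f) =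
      Fintype.piFinset fun n => Fintype.piFinset fun b =>
        if (n, b) ∈ A then {f n b} else univ := by
    ext f'
    simp only [mem_filter, mem_univ, true_and, mask_eq_iff, Fintype.mem_piFinset, Prod.forall]
    refine forall₂_congr fun n b => ?_
    by_cases h : (n, b) ∈ A <;> simp [h]
  -- The bits outside `A` are free.
  have h2 : #(univ.filter fun f' : Library N B => mask A f' = mask A f) = 2 ^ #Aᶜ := by
    rw [h1, Fintype.card_piFinset]
    simp only [Fintype.card_piFinset]
    rw [← Fintype.prod_prod_type' (f := fun n b =>
      #(if (n, b) ∈ A then ({f n b} : Finset Bool) else univ))]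
    have : ∀ p : Fin N × Fin B, #(if (p.1, p.2) ∈ A then ({f p.1 p.2} : Finset Bool) else univ) =
        if p ∈ Aᶜ then 2 else 1 := by
      intro p
      by_cases h : p ∈ A <;> simp [h]
    simp only [this]
    rw [Finset.prod_ite_mem, Finset.univ_inter, Finset.prod_const]
  have h3 : #Aᶜ + #A = N * B := by
    rw [Finset.card_compl_add_card]; simp
  rw [prob, Finset.sum_congr (s₂ := univ.filter fun f' : Library N B => mask A f' = mask A f)
    (by ext; simp) fun _ _ => rfl]
  simp only [libraryLaw, Finset.sum_const, h2, ← h3, nsmul_eq_mul, pow_add]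
  push_cast
  rw [← mul_assoc, ← mul_pow]
  norm_num

lemma entropy_mask (A : Finset (Fin N × Fin B)) : entropy (libraryLaw N B) (mask A) = #A := by
  rw [entropy_eq_sum]
  simp only [prob_mask]
  rw [← Finset.sum_mul, sum_libraryLaw, one_mul, Real.logb_pow, one_div, Real.logb_inv,
    Real.logb_self_eq_one (by norm_num)]
  ring

/-- The positions of the bits of file `i`. -/
def filePos (B : ℕ) (i : Fin N) : Finset (Fin N × Fin B) := univ.filter fun p => p.1 = i

lemma mask_filePos_eq_iff {i : Fin N} {f f' : Library N B} :
    mask (filePos B i) f = mask (filePos B i) f' ↔ f i = f' i := by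
  rw [mask_eq_iff]
  constructor
  · intro h; funext b; exact h (i, b) (by simp [filePos])
  · rintro h ⟨i', b⟩ hp
    obtain rfl : i' = i := by simpa [filePos] using hp
    exact congrFun h b

lemma condEntropy_mask_mask (A A' : Finset (Fin N × Fin B)) :
    condEntropy (libraryLaw N B) (mask A) (mask A') = #(A \ A') := by
  have h : entropy (libraryLaw N B) (fun f => (mask A f, mask A' f)) =
      entropy (libraryLaw N B) (mask (A \ A' ∪ A')) := by
    refine entropy_congr fun f f' _ _ => ?_
    simp only [Prod.mk.injEq, mask_eq_iff, Finset.sdiff_union_self_eq_union, mem_union, or_imp,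
      forall_and]
  rw [condEntropy, h, entropy_mask, entropy_mask, card_union_of_disjoint sdiff_disjoint]
  push_cast
  ring

/-- One step of successive decoding: expand the joint entropy of `G` and the bits in `A`, given
those in `W ∪ S`, in both orders. The still unknown bits of `A` must come from `G`, up to the
equivocation of `A` given `G` and `S`. -/
lemma condEntropy_mask_step {α : Type*} (G : Library N B → α) (W S A : Finset (Fin N × Fin B)) :
    condEntropy (libraryLaw N B) G (mask (W ∪ S ∪ A)) + #(A \ (W ∪ S)) -
        condEntropy (libraryLaw N B) (mask A) (fun f => (G f, mask S f)) ≤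
      condEntropy (libraryLaw N B) G (mask W) := by
  have hw := libraryLaw_nonneg (N := N) (B := B)
  have h1 := condEntropy_prodMk (libraryLaw N B) G (mask A) (mask (W ∪ S))
  have h2 := condEntropy_prodMk (libraryLaw N B) (mask A) G (mask (W ∪ S))
  have h3 : condEntropy (libraryLaw N B) (fun f => (G f, mask A f)) (mask (W ∪ S)) =
      condEntropy (libraryLaw N B) (fun f => (mask A f, G f)) (mask (W ∪ S)) :=
    condEntropy_congr (fun _ _ => Iff.rfl) fun f f' _ => by simp [and_comm]
  have h4 : condEntropy (libraryLaw N B) G (fun f => (mask A f, mask (W ∪ S) f)) =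
      condEntropy (libraryLaw N B) G (mask (W ∪ S ∪ A)) := by
    refine condEntropy_congr (fun f f' => ?_) fun _ _ _ => Iff.rfl
    simp only [Prod.mk.injEq, mask_eq_iff, mem_union, or_imp, forall_and]
    tauto
  have h5 : condEntropy (libraryLaw N B) (mask A) (fun f => (G f, mask (W ∪ S) f)) ≤
      condEntropy (libraryLaw N B) (mask A) (fun f => (G f, mask S f)) := by
    refine condEntropy_anti hw _ fun f f' h => ?_
    simp only [Prod.mk.injEq, mask_eq_iff] at h ⊢
    exact ⟨h.1, fun p hp => h.2 p (mem_union_right _ hp)⟩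
  have h6 : condEntropy (libraryLaw N B) G (mask (W ∪ S)) ≤
      condEntropy (libraryLaw N B) G (mask W) := by
    refine condEntropy_anti hw _ fun f f' h => ?_
    simp only [mask_eq_iff] at h ⊢
    exact fun p hp => h p (mem_union_left _ hp)
  have h7 := condEntropy_mask_mask A (W ∪ S)
  linarith

/-- If the files `i r`, `r < n`, can each be recovered from a signal `G` together with the bits at
the positions `S r`, up to the equivocations on the right, then `G` is long. -/
lemma sum_le_entropy_of_decoding {α : Type*} (G : Library N B → α) (V : Finset (Fin N × Fin B))
    (S : ℕ → Finset (Fin N × Fin B)) (i : ℕ → Fin N) (n : ℕ) (hi : Set.InjOn i (Set.Iio n)) :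
    ∑ r ∈ range n, ((#(filePos B (i r) ∩ V) : ℝ) -
        condEntropy (libraryLaw N B) (mask (filePos B (i r))) (fun f => (G f, mask (S r) f)) -
        ∑ s ∈ range (r + 1), (#(filePos B (i r) ∩ V ∩ S s) : ℝ)) ≤
      entropy (libraryLaw N B) G := by
  classical
  have hw := libraryLaw_nonneg (N := N) (B := B)
  -- Everything known after `m` steps: the bits outside `V`, revealed for free, the side information
  -- used so far, and the files already decoded.
  let W : ℕ → Finset (Fin N × Fin B) := fun m =>
    Vᶜ ∪ (range m).biUnion fun r => S r ∪ filePos B (i r)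
  have hW : ∀ m, W (m + 1) = W m ∪ S m ∪ filePos B (i m) := fun m => by
    simp only [W, Finset.range_add_one, Finset.biUnion_insert]
    ext p
    simp only [mem_union]
    tauto
  have key : ∀ m ≤ n, condEntropy (libraryLaw N B) G (mask (W m)) +
      ∑ r ∈ range m, ((#(filePos B (i r) ∩ V) : ℝ) -
        condEntropy (libraryLaw N B) (mask (filePos B (i r))) (fun f => (G f, mask (S r) f)) -
        ∑ s ∈ range (r + 1), (#(filePos B (i r) ∩ V ∩ S s) : ℝ)) ≤
      entropy (libraryLaw N B) G := by
    intro m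
    induction m with
    | zero =>
      intro _
      simpa using condEntropy_le_entropy hw sum_libraryLaw G _
    | succ m ih =>
      intro hm
      have h1 := ih (by omega)
      have h2 := condEntropy_mask_step G (W m) (S m) (filePos B (i m))
      rw [← hW] at h2
      -- A bit of file `i m` in `V` is either new or lies in one of `S 0, …, S m`; injectivity of
      -- `i` excludes the files decoded earlier.
      have h3 : filePos B (i m) ∩ V ⊆ (filePos B (i m) \ (W m ∪ S m)) ∪
          (range (m + 1)).biUnion fun s => filePos B (i m) ∩ V ∩ S s := by
        intro p hp
        simp only [mem_inter, filePos, mem_filter, mem_univ, true_and] at hp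
        simp only [mem_union, Finset.mem_sdiff, mem_biUnion, mem_range, mem_inter, W, Finset.mem_compl, filePos,
          mem_filter, mem_univ, true_and]
        by_cases hex : ∃ s < m + 1, p ∈ S s
        · obtain ⟨s, hs, hps⟩ := hex
          exact .inr ⟨s, hs, hp, hps⟩
        · push Not at hex
          refine .inl ⟨hp.1, ?_⟩
          rintro ((h | ⟨r, hr, h | h⟩) | h)
          · exact h hp.2
          · exact hex r (by omega) h
          · have := hi (show r < n by omega) (show m < n by omega) (h.symm.trans hp.1)
            omega
          · exact hex m (by omega) h
      have h4 : (#(filePos B (i m) ∩ V) : ℝ) ≤ #(filePos B (i m) \ (W m ∪ S m)) +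
          ∑ s ∈ range (m + 1), (#(filePos B (i m) ∩ V ∩ S s) : ℝ) := by
        exact_mod_cast (card_le_card h3).trans ((card_union_le _ _).trans
          (Nat.add_le_add_left card_biUnion_le _))
      rw [Finset.sum_range_succ]
      linarith
  have h1 := key n le_rfl
  have h2 := condEntropy_nonneg hw G (mask (W n))
  linarith

end D2DCaching

/-! ### From entropies of a scheme to averages over metadata, and the use of privacy. -/

namespace D2DCaching.Scheme

variable {K N B : ℕ} (S : Scheme K N B) {μ : Demand K N → ℝ}

/-- Joint values of the cache metadata and of the packet metadata. -/
abbrev Meta : Type := (∀ k, S.C k) × (∀ k, S.P k)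

/-- The joint law of all metadata when the demand vector is `d`. -/
noncomputable def metaLaw (d : Demand K N) (ξ : S.Meta) : ℝ := S.placement ξ.1 * S.query d ξ.1 ξ.2

lemma metaLaw_nonneg (d : Demand K N) (ξ : S.Meta) : 0 ≤ S.metaLaw d ξ :=
  mul_nonneg (S.placement_mem.1 _) ((S.query_mem _ _).1 _)

/-- The sample space as a product of the demands and metadata with the libraries. -/
def sampleEquiv : (Demand K N × S.Meta) × Library N B ≃ S.Sample where
  toFun x := (x.1.1, x.1.2.1, x.1.2.2, x.2)
  invFun ω := ((ω.1, ω.2.1, ω.2.2.1), ω.2.2.2)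
  left_inv _ := rfl
  right_inv _ := rfl

lemma law_sampleEquiv (m : Demand K N × S.Meta) (f : Library N B) :
    S.law μ (S.sampleEquiv (m, f)) = (μ m.1 * S.metaLaw m.1 m.2) * libraryLaw N B f := by
  simp only [law, sampleEquiv, metaLaw, libraryLaw, Equiv.coe_fn_mk]
  ring

lemma law_nonneg (hμ : ∀ d, 0 < μ d) (ω : S.Sample) : 0 ≤ S.law μ ω := by
  have h1 := S.placement_mem.1 ω.2.1
  have h2 := (S.query_mem ω.1 ω.2.1).1 ω.2.2.1
  have h3 := (hμ ω.1).le
  unfold law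
  positivity

lemma sum_metaLaw_mul (d : Demand K N) (φ : (∀ k, S.C k) → ℝ) :
    ∑ ξ, S.metaLaw d ξ * φ ξ.1 = ∑ c, S.placement c * φ c := by
  rw [Fintype.sum_prod_type]
  refine Finset.sum_congr rfl fun c _ => ?_
  simp only [metaLaw]
  rw [← Finset.sum_mul, ← Finset.mul_sum, (S.query_mem d c).2, mul_one]

lemma sum_law (hμ1 : ∑ d, μ d = 1) : ∑ ω, S.law μ ω = 1 := by
  rw [← S.sampleEquiv.sum_comp, Fintype.sum_prod_type]
  simp only [law_sampleEquiv, ← Finset.mul_sum, sum_libraryLaw, mul_one]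
  rw [Fintype.sum_prod_type]
  simp only [← Finset.mul_sum]
  have : ∀ d, ∑ ξ, S.metaLaw d ξ = 1 := fun d => by
    have := S.sum_metaLaw_mul d fun _ => 1
    simpa [S.placement_mem.2] using this
  simp [this, hμ1]

/-- The equivocation of file `i` at user `k` given the metadata `ξ`. -/
noncomputable def equivocation (k : Fin K) (i : Fin N) (ξ : S.Meta) : ℝ :=
  condEntropy (libraryLaw N B) (fun f => f i)
    (fun f => (fun j => S.payload j (ξ.2 j) f, S.content k (ξ.1 k) f))

lemma equivocation_nonneg (k : Fin K) (i : Fin N) (ξ : S.Meta) : 0 ≤ S.equivocation k i ξ :=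
  condEntropy_nonneg libraryLaw_nonneg _ _

variable {S}

lemma payload_eq_of_encoding (hμ : ∀ d, 0 < μ d) (h : S.Encoding μ) {d : Demand K N} {ξ : S.Meta}
    (hξ : S.metaLaw d ξ ≠ 0) (k : Fin K) {f f' : Library N B}
    (hf : S.content k (ξ.1 k) f = S.content k (ξ.1 k) f') :
    S.payload k (ξ.2 k) f = S.payload k (ξ.2 k) f' := by
  have h1 := eq_of_condEntropy_eq_zero (S.law_nonneg hμ) (h k)
    (ω := S.sampleEquiv ((d, ξ), f)) (ω' := S.sampleEquiv ((d, ξ), f'))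
    (by rw [law_sampleEquiv]; exact mul_ne_zero (mul_ne_zero (hμ d).ne' hξ) (libraryLaw_ne_zero f))
    (by rw [law_sampleEquiv]; exact mul_ne_zero (mul_ne_zero (hμ d).ne' hξ) (libraryLaw_ne_zero f'))
    (by simp [sampleEquiv, metaP, Z, F, hf])
  simpa [X, sampleEquiv, metaP, F] using h1

/-- Conditioning also on all demands and metadata only lowers the equivocation, and the demand `d`
enters the resulting average with weight `μ d`. -/
lemma sum_equivocation_le (hμ : ∀ d, 0 < μ d) {ε : ℝ} (h : S.Decoding μ ε) (k : Fin K)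
    (d : Demand K N) : ∑ ξ, S.metaLaw d ξ * S.equivocation k (d k) ξ ≤ B * ε / μ d := by
  rw [le_div_iff₀ (hμ d)]
  have h1 := condEntropy_anti (S.law_nonneg hμ) (fun ω => S.F ω (S.D ω k))
    (Y := fun ω => ((S.allX ω, S.Z k ω), (S.sampleEquiv.symm ω).1))
    (Z := fun ω => (S.allX ω, S.Z k ω, S.D ω k)) (by
      intro ω ω' h
      simp only [Prod.mk.injEq, sampleEquiv, Equiv.coe_fn_symm_mk] at h
      simp only [h.1, D, h.2])
  rw [condEntropy_prodMk_fst_eq_sum S.sampleEquiv libraryLaw_nonneg sum_libraryLaw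
    S.law_sampleEquiv, Fintype.sum_prod_type] at h1
  refine le_trans ?_ (h1.trans (h k))
  have h2 : ∀ d ξ, condEntropy (libraryLaw N B)
      (fun l => S.F (S.sampleEquiv ((d, ξ), l)) (S.D (S.sampleEquiv ((d, ξ), l)) k))
      (fun l => (S.allX (S.sampleEquiv ((d, ξ), l)), S.Z k (S.sampleEquiv ((d, ξ), l)))) =
        S.equivocation k (d k) ξ := by
    intro d ξ
    refine condEntropy_congr (fun f f' => ?_) fun f f' _ => by simp [sampleEquiv, F, D]
    simp [sampleEquiv, allX, X, Z, metaP, F, funext_iff]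
  simp only [h2, mul_assoc, ← Finset.mul_sum]
  rw [mul_comm]
  exact Finset.single_le_sum (f := fun d => μ d * ∑ ξ, S.metaLaw d ξ * S.equivocation k (d k) ξ)
    (fun d _ => mul_nonneg (hμ d).le (Finset.sum_nonneg fun ξ _ =>
      mul_nonneg (S.metaLaw_nonneg d ξ) (S.equivocation_nonneg k _ ξ))) (mem_univ d)

lemma sum_entropy_payload_le (hμ : ∀ d, 0 < μ d) (hμ1 : ∑ d, μ d = 1) (k : Fin K) :
    ∑ d, μ d * ∑ ξ, S.metaLaw d ξ * entropy (libraryLaw N B) (S.payload k (ξ.2 k)) ≤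
      entropy (S.law μ) (S.X k) := by
  refine le_trans (le_of_eq ?_) (condEntropy_le_entropy (S.law_nonneg hμ) (S.sum_law hμ1) (S.X k)
    (fun ω => (S.sampleEquiv.symm ω).1))
  rw [condEntropy_fst_eq_sum S.sampleEquiv libraryLaw_nonneg sum_libraryLaw S.law_sampleEquiv,
    Fintype.sum_prod_type]
  refine Finset.sum_congr rfl fun d _ => ?_
  rw [Finset.mul_sum]
  refine Finset.sum_congr rfl fun ξ _ => ?_
  rw [mul_assoc]
  congr 2
  exact entropy_congr fun f f' _ _ => by simp [X, sampleEquiv, metaP, F]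

/-- `pos` gives the set of positions of the bits cached by each user. -/
def IsCachePos (S : Scheme K N B) (pos : ∀ k, S.C k → Finset (Fin N × Fin B)) : Prop :=
  ∀ k c f f', S.content k c f = S.content k c f' ↔ mask (pos k c) f = mask (pos k c) f'

/-- Order and repetitions in the list of copied positions do not affect what the cache determines.
-/
lemma Uncoded.exists_isCachePos (h : S.Uncoded) : ∃ pos, S.IsCachePos pos := by
  choose pos hpos using h
  refine ⟨fun k c => (pos k c).toFinset, fun k c f f' => ?_⟩
  rw [hpos, hpos, mask_eq_iff]
  simp

variable {pos : ∀ k, S.C k → Finset (Fin N × Fin B)}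

/-- Given the metadata, an uncoded cache is a set of independent uniform bits, so its entropy is
their number; conditioning on metadata does not increase entropy. -/
lemma sum_card_cachePos_le (hμ : ∀ d, 0 < μ d) (hμ1 : ∑ d, μ d = 1) (hpos : S.IsCachePos pos)
    {M ε : ℝ} (h : S.CacheSize μ M ε) (k : Fin K) :
    ∑ c, S.placement c * (#(pos k (c k)) : ℝ) ≤ B * (M + ε) := by
  refine le_trans (le_of_eq ?_) ((condEntropy_le_entropy (S.law_nonneg hμ) (S.sum_law hμ1) (S.Z k)
    (fun ω => (S.sampleEquiv.symm ω).1)).trans (h k))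
  rw [condEntropy_fst_eq_sum S.sampleEquiv libraryLaw_nonneg sum_libraryLaw S.law_sampleEquiv,
    Fintype.sum_prod_type]
  have h1 : ∀ d (ξ : S.Meta),
      entropy (libraryLaw N B) (fun l => S.Z k (S.sampleEquiv ((d, ξ), l))) =
        #(pos k (ξ.1 k)) := by
    intro d ξ
    rw [← entropy_mask]
    refine entropy_congr fun f f' _ _ => ?_
    rw [← hpos k (ξ.1 k)]
    simp [Z, sampleEquiv, F]
  simp only [h1, mul_assoc, ← Finset.mul_sum]
  simp only [S.sum_metaLaw_mul _ fun c => (#(pos k (c k)) : ℝ)]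
  rw [← Finset.sum_mul, hμ1, one_mul]

/-- The metadata known to everybody but user `k`. -/
def metaExcept (S : Scheme K N B) (k : Fin K) (ξ : S.Meta) :
    (∀ k, S.P k) × (∀ j : ({k}ᶜ : Finset (Fin K)), S.C j) :=
  (ξ.2, fun j => ξ.1 j)

/-- The metadata known to everybody but user `k` do not depend on the demand of user `k`. -/
lemma prob_metaExcept_eq (hK : 2 ≤ K) (hμ : ∀ d, 0 < μ d) (h : S.PrivateAgainstCollusion μ)
    (k : Fin K) {d d' : Demand K N} (hd : ∀ j ≠ k, d j = d' j) (ξ : S.Meta) :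
    prob (S.metaLaw d) (S.metaExcept k) (S.metaExcept k ξ) =
      prob (S.metaLaw d') (S.metaExcept k) (S.metaExcept k ξ) := by
  classical
  have hT : ({k}ᶜ : Finset (Fin K)).Nonempty := by
    rw [← Finset.card_pos, Finset.card_compl]
    simp; omega
  -- Privacy against the coalition of all users but `k`, retaining only the metadata among their
  -- observations.
  have h1 := condMutualInfo_comp_eq_zero (S.law_nonneg hμ)
    (Y' := fun ω => S.metaExcept k (S.sampleEquiv.symm ω).1.2) (by
      intro ω ω' hω
      simp only [Prod.mk.injEq, funext_iff, allX, X, metaP, Z] at hω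
      simp only [metaExcept, sampleEquiv, Equiv.coe_fn_symm_mk, Prod.mk.injEq]
      exact ⟨funext fun j => (hω.1 j).1, funext fun j => (hω.2 j).1⟩) (h _ hT)
  have h2 := (condMutualInfo_gibbs _ _ _ _ (S.law_nonneg hμ)).2 h1
  let e : ({k}ᶜ : Finset (Fin K)) → Fin N := fun j => d j
  have h3 : ∀ δ : Demand K N, (∀ j ≠ k, δ j = d j) → prob (S.law μ)
      (fun ω => (S.D ω, S.metaExcept k (S.sampleEquiv.symm ω).1.2,
        fun j : ({k}ᶜ : Finset (Fin K)) => S.D ω j)) (δ, S.metaExcept k ξ, e) =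
        μ δ * prob (S.metaLaw δ) (S.metaExcept k) (S.metaExcept k ξ) := by
    intro δ hδ
    simp only [prob_eq_sum_ite]
    rw [← S.sampleEquiv.sum_comp, Fintype.sum_prod_type, Fintype.sum_prod_type,
      Finset.sum_eq_single δ, Finset.mul_sum]
    · refine Finset.sum_congr rfl fun ξ' _ => ?_
      have : (fun j : ({k}ᶜ : Finset (Fin K)) => δ j) = e := by
        funext ⟨j, hj⟩
        exact hδ j (by simpa using hj)
      simp only [law_sampleEquiv, Equiv.symm_apply_apply]
      simp only [D, sampleEquiv, Equiv.coe_fn_mk, this, Prod.mk.injEq, true_and, and_true]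
      by_cases hc : S.metaExcept k ξ' = S.metaExcept k ξ
      · simp [hc, ← Finset.mul_sum, sum_libraryLaw]
      · simp [hc]
    · intro δ' _ hne
      simp [D, sampleEquiv, hne]
    · simp
  have h4 : ∀ δ : Demand K N, (∀ j ≠ k, δ j = d j) → prob (S.law μ)
      (fun ω => (S.D ω, fun j : ({k}ᶜ : Finset (Fin K)) => S.D ω j)) (δ, e) = μ δ := by
    intro δ hδ
    simp only [prob_eq_sum_ite]
    rw [← S.sampleEquiv.sum_comp, Fintype.sum_prod_type, Fintype.sum_prod_type,
      Finset.sum_eq_single δ]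
    · have : (fun j : ({k}ᶜ : Finset (Fin K)) => δ j) = e := by
        funext ⟨j, hj⟩
        exact hδ j (by simpa using hj)
      simp only [law_sampleEquiv]
      simp only [D, sampleEquiv, Equiv.coe_fn_mk, this]
      simp only [if_true, ← Finset.mul_sum, sum_libraryLaw, mul_one]
      have := S.sum_metaLaw_mul δ fun _ => 1
      simp only [mul_one, S.placement_mem.2] at this
      rw [this, mul_one]
    · intro δ' _ hne
      simp [D, sampleEquiv, hne]
    · simp
  have h5 : prob (S.law μ) (fun ω => fun j : ({k}ᶜ : Finset (Fin K)) => S.D ω j) e ≠ 0 := by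
    refine (lt_of_lt_of_le (hμ d) ?_).ne'
    rw [← h4 d fun _ _ => rfl]
    exact prob_mono (S.law_nonneg hμ) fun ω hω => (Prod.ext_iff.1 hω).2
  -- The independence identities for `d` and `d'` share the coalition's demands `e`; cancelling the
  -- positive weights `μ d`, `μ d'` and the probability of `e` leaves the claim.
  have h6 := h2 d (S.metaExcept k ξ) e
  have h7 := h2 d' (S.metaExcept k ξ) e
  rw [h3 d fun _ _ => rfl, h4 d fun _ _ => rfl, mul_assoc] at h6
  rw [h3 d' fun j hj => (hd j hj).symm, h4 d' fun j hj => (hd j hj).symm, mul_assoc] at h7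
  have h8 := mul_left_cancel₀ (hμ d).ne' h6
  have h9 := mul_left_cancel₀ (hμ d').ne' h7
  exact mul_right_cancel₀ h5 (h8.trans h9.symm)

end D2DCaching.Scheme

/-! ### The converse for one scheme, averaged over placements. -/

namespace D2DCaching.Scheme

variable {K N B : ℕ} {S : Scheme K N B} {μ : Demand K N → ℝ}
  {pos : ∀ k, S.C k → Finset (Fin N × Fin B)}

/-- The positions of the bits cached by some user other than `k`. -/
def posExcept (pos : ∀ k, S.C k → Finset (Fin N × Fin B)) (k : Fin K) (c : ∀ k, S.C k) :
    Finset (Fin N × Fin B) :=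
  ({k}ᶜ : Finset (Fin K)).biUnion fun j => pos j (c j)

/-- The positions of all cached bits. -/
def posAll (pos : ∀ k, S.C k → Finset (Fin N × Fin B)) (c : ∀ k, S.C k) :
    Finset (Fin N × Fin B) :=
  univ.biUnion fun j => pos j (c j)

lemma posExcept_union (k : Fin K) (c : ∀ k, S.C k) :
    posExcept pos k c ∪ pos k (c k) = posAll pos c := by
  ext p
  simp only [posExcept, posAll, mem_union, mem_biUnion, Finset.mem_compl, mem_singleton, mem_univ,
    true_and]
  constructor
  · rintro (⟨j, -, h⟩ | h)
    exacts [⟨j, h⟩, ⟨k, h⟩]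
  · rintro ⟨j, h⟩
    by_cases hj : j = k
    · exact .inr (hj ▸ h)
    · exact .inl ⟨j, hj, h⟩

/-- The average length, given the demands `d`, of the packets sent by user `j`. -/
noncomputable def payloadEntropy (S : Scheme K N B) (d : Demand K N) (j : Fin K) : ℝ :=
  ∑ ξ, S.metaLaw d ξ * entropy (libraryLaw N B) (S.payload j (ξ.2 j))

/-- The average over the placements. -/
noncomputable def mean (S : Scheme K N B) (φ : (∀ k, S.C k) → ℝ) : ℝ := ∑ c, S.placement c * φ c

lemma mean_sum {ι : Type*} (s : Finset ι) (φ : ι → (∀ k, S.C k) → ℝ) :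
    S.mean (fun c => ∑ i ∈ s, φ i c) = ∑ i ∈ s, S.mean (φ i) := by
  simp only [mean, Finset.mul_sum]
  rw [Finset.sum_comm]

lemma mean_mono {φ ψ : (∀ k, S.C k) → ℝ} (h : ∀ c, φ c ≤ ψ c) : S.mean φ ≤ S.mean ψ :=
  Finset.sum_le_sum fun c _ => mul_le_mul_of_nonneg_left (h c) (S.placement_mem.1 c)

lemma mean_add (φ ψ : (∀ k, S.C k) → ℝ) : S.mean (fun c => φ c + ψ c) = S.mean φ + S.mean ψ := by
  simp only [mean, mul_add, Finset.sum_add_distrib]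

lemma mean_mul_left (a : ℝ) (φ : (∀ k, S.C k) → ℝ) :
    S.mean (fun c => a * φ c) = a * S.mean φ := by
  simp only [mean, Finset.mul_sum, mul_left_comm]

lemma mean_const (a : ℝ) : S.mean (fun _ => a) = a := by
  rw [mean, ← Finset.sum_mul, S.placement_mem.2, one_mul]

/-- Private delivery to user `k` of the files `i r`, `r < n`: no packet of the other users may
depend on which of them is demanded, so that the packets serve all of them. -/
lemma sum_mean_le_of_private (hK : 2 ≤ K) (hμ : ∀ d, 0 < μ d) (hpos : S.IsCachePos pos)
    (hE : S.Encoding μ) (hP : S.PrivateAgainstCollusion μ) {δ : ℝ}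
    (hδ : ∀ k d, ∑ ξ, S.metaLaw d ξ * S.equivocation k (d k) ξ ≤ δ) (k : Fin K) (d : Demand K N)
    (i : ℕ → Fin N) (n : ℕ) (hi : Set.InjOn i (Set.Iio n)) :
    ∑ r ∈ range n, (S.mean (fun c => #(filePos B (i r) ∩ posExcept pos k c)) - δ -
        ∑ s ∈ Ico r n, S.mean fun c => #(filePos B (i s) ∩ posExcept pos k c ∩ pos k (c k))) ≤
      ∑ j ∈ ({k}ᶜ : Finset (Fin K)), S.payloadEntropy d j := by
  classical
  -- The law `ν r` is that of the metadata when user `k` demands file `i r`. By privacy these laws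
  -- agree on `metaExcept k`.
  have hsel := sum_le_of_forall_selection (S.metaExcept k) n
    (ν := fun r => S.metaLaw (Function.update d k (i r))) (ν₀ := S.metaLaw d)
    (fun r => S.metaLaw_nonneg _) (S.metaLaw_nonneg d)
    (fun r _ ξ => prob_metaExcept_eq hK hμ hP k (fun j hj => by simp [hj]) ξ)
    (fun ξ => ∑ j ∈ ({k}ᶜ : Finset (Fin K)), entropy (libraryLaw N B) (S.payload j (ξ.2 j)))
    (fun r ξ => (#(filePos B (i r) ∩ posExcept pos k ξ.1) : ℝ) - S.equivocation k (i r) ξ -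
      ∑ s ∈ Ico r n, (#(filePos B (i s) ∩ posExcept pos k ξ.1 ∩ pos k (ξ.1 k)) : ℝ)) ?_
  · have hL : ∑ ξ, S.metaLaw d ξ *
        ∑ j ∈ ({k}ᶜ : Finset (Fin K)), entropy (libraryLaw N B) (S.payload j (ξ.2 j)) =
        ∑ j ∈ ({k}ᶜ : Finset (Fin K)), S.payloadEntropy d j := by
      simp only [payloadEntropy, Finset.mul_sum]
      rw [Finset.sum_comm]
    rw [hL] at hsel
    refine le_trans (Finset.sum_le_sum fun r _ => ?_) hsel
    simp only [mul_sub, Finset.sum_sub_distrib]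
    rw [S.sum_metaLaw_mul _ fun c => (#(filePos B (i r) ∩ posExcept pos k c) : ℝ),
      S.sum_metaLaw_mul _ fun c =>
        ∑ s ∈ Ico r n, (#(filePos B (i s) ∩ posExcept pos k c ∩ pos k (c k)) : ℝ)]
    have h1 := hδ k (Function.update d k (i r))
    rw [Function.update_self] at h1
    have h2 := mean_sum (S := S) (Ico r n) fun s c =>
      (#(filePos B (i s) ∩ posExcept pos k c ∩ pos k (c k)) : ℝ)
    rw [← h2]
    simp only [mean]
    linarith
  · intro ξ₀ hξ₀ sel hs
    have hP' : ∀ r < n, (sel r).2 = ξ₀.2 := fun r hr => (Prod.ext_iff.1 (hs r hr).1).1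
    have hC' : ∀ r < n, ∀ j ≠ k, (sel r).1 j = ξ₀.1 j := fun r hr j hj =>
      congrFun (Prod.ext_iff.1 (hs r hr).1).2 ⟨j, by simpa using hj⟩
    have hV : ∀ r < n, posExcept pos k (sel r).1 = posExcept pos k ξ₀.1 := by
      intro r hr
      refine Finset.biUnion_congr rfl fun j hj => ?_
      rw [hC' r hr j (by simpa using hj)]
    refine le_trans ?_ (entropy_pi_le libraryLaw_nonneg sum_libraryLaw
      (fun j => S.payload j (ξ₀.2 j)) ({k}ᶜ : Finset (Fin K)))
    refine le_trans ?_ (sum_le_entropy_of_decoding _ (posExcept pos k ξ₀.1)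
      (fun r => pos k ((sel r).1 k)) i n hi)
    simp only [Finset.sum_sub_distrib]
    -- Regroup the overlaps by the hypothetical cache involved, so that each term depends on a
    -- single `sel r` and can be averaged under its own law: the cache of step `r` is charged for
    -- file `i r` and all later ones.
    have hswap : ∑ r ∈ range n, ∑ s ∈ range (r + 1),
        (#(filePos B (i r) ∩ posExcept pos k ξ₀.1 ∩ pos k ((sel s).1 k)) : ℝ) =
        ∑ r ∈ range n, ∑ s ∈ Ico r n,
          (#(filePos B (i s) ∩ posExcept pos k (sel r).1 ∩ pos k ((sel r).1 k)) : ℝ) := by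
      have : ∀ r ∈ range n, ∑ s ∈ Ico r n,
          (#(filePos B (i s) ∩ posExcept pos k (sel r).1 ∩ pos k ((sel r).1 k)) : ℝ) =
          ∑ s ∈ Ico r n,
          (#(filePos B (i s) ∩ posExcept pos k ξ₀.1 ∩ pos k ((sel r).1 k)) : ℝ) := by
        intro r hr
        rw [hV r (mem_range.1 hr)]
      rw [Finset.sum_congr rfl this]
      refine Finset.sum_comm' fun r s => ?_
      simp only [mem_range, mem_Ico]
      omega
    rw [hswap]
    refine sub_le_sub_right (sub_le_sub (Finset.sum_le_sum fun r hr => ?_)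
      (Finset.sum_le_sum fun r hr => ?_)) _
    · rw [hV r (mem_range.1 hr)]
    · have hr' := mem_range.1 hr
      have h1 : condEntropy (libraryLaw N B) (mask (filePos B (i r)))
          (fun f => ((fun j : ({k}ᶜ : Finset (Fin K)) => S.payload j (ξ₀.2 j) f),
            mask (pos k ((sel r).1 k)) f)) =
          condEntropy (libraryLaw N B) (fun f => f (i r))
          (fun f => ((fun j : ({k}ᶜ : Finset (Fin K)) => S.payload j (ξ₀.2 j) f),
            mask (pos k ((sel r).1 k)) f)) :=
        condEntropy_congr (fun _ _ => Iff.rfl) fun f f' _ => mask_filePos_eq_iff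
      rw [h1]
      refine condEntropy_anti libraryLaw_nonneg _ fun f f' h => ?_
      simp only [Prod.mk.injEq] at h ⊢
      rw [← hpos] at h
      refine ⟨funext fun j => ?_, h.2⟩
      -- The packet of user `k` itself comes for free with the hypothetical cache, by the encoding
      -- constraint; all other packets are shared.
      by_cases hj : j = k
      · subst hj
        exact payload_eq_of_encoding hμ hE (hs r hr').2 j h.2
      · rw [hP' r hr']
        exact congrFun h.1 ⟨j, by simpa using hj⟩

lemma sum_card_filePos_inter (A : Finset (Fin N × Fin B)) :
    ∑ i, (#(filePos B i ∩ A) : ℝ) = #A := by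
  have := Finset.card_eq_sum_card_fiberwise (s := A) (t := univ) (f := Prod.fst) fun _ _ => by simp
  rw [this]
  push_cast
  refine Finset.sum_congr rfl fun i _ => ?_
  congr 2
  ext p
  simp [filePos, and_comm]

/-- Summing over the `N` cyclic windows `a, a + 1, …, a + n - 1` puts every file once in each place,
so only totals over all files survive. The coefficient of the overlap is the sum of `n - r` over `r
< n`. -/
lemma mean_le_payloadEntropy [NeZero N] (hK : 2 ≤ K) (hμ : ∀ d, 0 < μ d)
    (hpos : S.IsCachePos pos) (hE : S.Encoding μ) (hP : S.PrivateAgainstCollusion μ) {δ : ℝ}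
    (hδ : ∀ k d, ∑ ξ, S.metaLaw d ξ * S.equivocation k (d k) ξ ≤ δ) (k : Fin K) (d : Demand K N)
    {n : ℕ} (hn : n ≤ N) :
    n * (S.mean (fun c => #(posExcept pos k c)) - N * δ) -
        n * (n + 1) / 2 * S.mean (fun c => #(posExcept pos k c ∩ pos k (c k))) ≤
      N * ∑ j ∈ ({k}ᶜ : Finset (Fin K)), S.payloadEntropy d j := by
  have h1 : ∀ a : Fin N, _ := fun a => sum_mean_le_of_private hK hμ hpos hE hP hδ k d
    (fun r => a + Fin.ofNat N r) n (by
      intro r hr s hs h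
      have h2 := congrArg Fin.val (add_left_cancel h)
      simp only [Fin.ofNat, Set.mem_Iio] at h2 hr hs
      rwa [Nat.mod_eq_of_lt (by omega), Nat.mod_eq_of_lt (by omega)] at h2)
  have h2 := Finset.sum_le_sum fun a (_ : a ∈ (univ : Finset (Fin N))) => h1 a
  rw [Finset.sum_const, Finset.card_univ, Fintype.card_fin, nsmul_eq_mul] at h2
  refine le_trans (le_of_eq ?_) h2
  have hshift : ∀ (φ : Fin N → ℝ) (r : ℕ), ∑ a, φ (a + Fin.ofNat N r) = ∑ a, φ a := fun φ r =>
    Equiv.sum_comp (Equiv.addRight (Fin.ofNat N r)) φ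
  have hv : ∑ i : Fin N, S.mean (fun c => #(filePos B i ∩ posExcept pos k c)) =
      S.mean (fun c => #(posExcept pos k c)) := by
    rw [← mean_sum]
    simp only [sum_card_filePos_inter]
  have hy : ∑ i : Fin N, S.mean (fun c => #(filePos B i ∩ posExcept pos k c ∩ pos k (c k))) =
      S.mean (fun c => #(posExcept pos k c ∩ pos k (c k))) := by
    rw [← mean_sum]
    simp only [Finset.inter_assoc, sum_card_filePos_inter]
  rw [Finset.sum_comm]
  have h3 : ∀ r ∈ range n, ∑ a : Fin N,
      (S.mean (fun c => #(filePos B (a + Fin.ofNat N r) ∩ posExcept pos k c)) - δ -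
        ∑ s ∈ Ico r n, S.mean fun c =>
          #(filePos B (a + Fin.ofNat N s) ∩ posExcept pos k c ∩ pos k (c k))) =
      S.mean (fun c => #(posExcept pos k c)) - N * δ -
        ((n : ℝ) - r) * S.mean (fun c => #(posExcept pos k c ∩ pos k (c k))) := by
    intro r hr
    rw [Finset.sum_sub_distrib, Finset.sum_sub_distrib, Finset.sum_comm (s := univ) (t := Ico r n)]
    rw [hshift fun i => S.mean (fun c => #(filePos B i ∩ posExcept pos k c)), hv]
    simp only [hshift fun i => S.mean (fun c =>
      #(filePos B i ∩ posExcept pos k c ∩ pos k (c k))), hy]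
    rw [Finset.sum_const, Finset.sum_const, Nat.card_Ico, Finset.card_univ, Fintype.card_fin,
      nsmul_eq_mul, nsmul_eq_mul, Nat.cast_sub (mem_range.1 hr).le]
  rw [Finset.sum_congr rfl h3, Finset.sum_sub_distrib, ← Finset.sum_mul, Finset.sum_sub_distrib,
    Finset.sum_const, Finset.sum_const, Finset.card_range, nsmul_eq_mul, nsmul_eq_mul]
  have h4 : ∀ m : ℕ, ∑ r ∈ range m, (r : ℝ) = m * (m - 1) / 2 := by
    intro m
    induction m with
    | zero => simp
    | succ m ih => rw [Finset.sum_range_succ, ih]; push_cast; ring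
  rw [Finset.sum_sub_distrib, h4, Finset.sum_const, Finset.card_range, nsmul_eq_mul]
  ring

/-- Almost all bits of the library are cached. -/
lemma le_mean_card_posAll (hμ : ∀ d, 0 < μ d) (hpos : S.IsCachePos pos) (hE : S.Encoding μ) {δ : ℝ}
    (hδ : ∀ k d, ∑ ξ, S.metaLaw d ξ * S.equivocation k (d k) ξ ≤ δ) (hK : 0 < K) :
    N * B - N * δ ≤ S.mean fun c => #(posAll pos c) := by
  have h1 : ∀ i : Fin N, S.mean (fun c => #(filePos B i \ posAll pos c)) ≤ δ := by
    intro i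
    -- Let everybody demand file `i`: all packets and caches are functions of the cached bits, so
    -- the uncached bits of `i` belong to the equivocation.
    refine le_trans ?_ (hδ ⟨0, hK⟩ fun _ => i)
    rw [mean, ← S.sum_metaLaw_mul (fun _ => i) fun c => (#(filePos B i \ posAll pos c) : ℝ)]
    refine Finset.sum_le_sum fun ξ _ => ?_
    by_cases hξ : S.metaLaw (fun _ => i) ξ = 0
    · simp [hξ]
    refine mul_le_mul_of_nonneg_left ?_ (S.metaLaw_nonneg _ _)
    rw [← condEntropy_mask_mask, equivocation]
    have h2 : condEntropy (libraryLaw N B) (mask (filePos B i)) (mask (posAll pos ξ.1)) =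
        condEntropy (libraryLaw N B) (fun f => f i) (mask (posAll pos ξ.1)) :=
      condEntropy_congr (fun _ _ => Iff.rfl) fun f f' _ => mask_filePos_eq_iff
    rw [h2]
    refine condEntropy_anti libraryLaw_nonneg _ fun f f' h => ?_
    have h3 : ∀ j, S.content j (ξ.1 j) f = S.content j (ξ.1 j) f' := by
      intro j
      rw [hpos, mask_eq_iff]
      rw [mask_eq_iff] at h
      exact fun p hp => h p (mem_biUnion.2 ⟨j, mem_univ _, hp⟩)
    simp only [Prod.mk.injEq]
    exact ⟨funext fun j => payload_eq_of_encoding hμ hE hξ j (h3 j), h3 _⟩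
  have h2 : ∀ c, (N * B : ℝ) = (#(posAll pos c) : ℝ) + ∑ i, (#(filePos B i \ posAll pos c) : ℝ) := by
    intro c
    have h3 : ∀ i, (#(filePos B i \ posAll pos c) : ℝ) = #(filePos B i ∩ (posAll pos c)ᶜ) := by
      intro i
      rw [Finset.sdiff_eq_inter_compl]
    simp only [h3, sum_card_filePos_inter]
    have := Finset.card_add_card_compl (posAll pos c)
    rw [Fintype.card_prod, Fintype.card_fin, Fintype.card_fin] at this
    exact_mod_cast this.symm
  have h3 := mean_const (S := S) (N * B)
  have h4 : S.mean (fun _ => (N * B : ℝ)) = S.mean (fun c => (#(posAll pos c) : ℝ)) +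
      ∑ i, S.mean (fun c => (#(filePos B i \ posAll pos c) : ℝ)) := by
    rw [← mean_sum, ← mean_add]
    exact congrArg S.mean (funext h2)
  have h5 := Finset.sum_le_sum fun i (_ : i ∈ (univ : Finset (Fin N))) => h1 i
  rw [Finset.sum_const, Finset.card_univ, Fintype.card_fin, nsmul_eq_mul] at h5
  linarith

/-- The overlaps of the caches are controlled by their total excess. -/
lemma sum_card_overlap_le (c : ∀ k, S.C k) :
    ∑ k, (#(posExcept pos k c ∩ pos k (c k)) : ℝ) + 2 * #(posAll pos c) ≤
      2 * ∑ k, (#(pos k (c k)) : ℝ) := by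
  have hcard : ∀ A : Finset (Fin N × Fin B), #A = ∑ p, if p ∈ A then 1 else 0 := fun A => by simp
  suffices h : ∑ k, #(posExcept pos k c ∩ pos k (c k)) + 2 * #(posAll pos c) ≤
      2 * ∑ k, #(pos k (c k)) by exact_mod_cast h
  simp only [hcard]
  rw [Finset.sum_comm (f := fun k p => if p ∈ posExcept pos k c ∩ pos k (c k) then 1 else 0),
    Finset.sum_comm (f := fun k p => if p ∈ pos k (c k) then 1 else 0), Finset.mul_sum,
    Finset.mul_sum, ← Finset.sum_add_distrib]
  -- Bit by bit: a bit in `m ≥ 1` caches contributes `m + 2` to the left if `m ≥ 2` and `2` if `m =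
  -- 1`, in both cases at most `2 m`.
  refine Finset.sum_le_sum fun p _ => ?_
  simp only [← Finset.card_filter]
  set m : Finset (Fin K) := univ.filter fun k => p ∈ pos k (c k) with hm
  have hsub : (univ.filter fun k => p ∈ posExcept pos k c ∩ pos k (c k)) ⊆ m := by
    intro k hk
    simp only [hm, mem_filter, mem_univ, true_and, mem_inter] at hk ⊢
    exact hk.2
  have h1 := card_le_card hsub
  by_cases hA : p ∈ posAll pos c
  · simp only [hA, if_true]
    obtain ⟨k, hk⟩ : m.Nonempty := by
      obtain ⟨k, -, hk⟩ := mem_biUnion.1 hA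
      exact ⟨k, by simpa [hm] using hk⟩
    by_cases h2 : 2 ≤ #m
    · omega
    · have h3 : #m = 1 := le_antisymm (by omega) (card_pos.2 ⟨k, hk⟩)
      obtain ⟨k', hk'⟩ := card_eq_one.1 h3
      have h4 : (univ.filter fun k => p ∈ posExcept pos k c ∩ pos k (c k)) = ∅ := by
        refine Finset.filter_eq_empty_iff.2 fun j _ hj => ?_
        simp only [posExcept, mem_inter, mem_biUnion, Finset.mem_compl, mem_singleton] at hj
        obtain ⟨⟨l, hl, hpl⟩, hpj⟩ := hj
        have h5 : l ∈ m := by simpa [hm] using hpl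
        have h6 : j ∈ m := by simpa [hm] using hpj
        rw [hk', mem_singleton] at h5 h6
        exact hl (h5.trans h6.symm)
      rw [h4, h3]; simp
  · simp only [hA, if_false]; omega

/-- Sum the bounds over `k`; each packet is counted for its `K - 1` receivers. With `A` cached bits,
total size `T` and total overlap `Y`, the sets cached by the others add up to `K A + Y - T`, and `Y
≤ 2 (T - A)` eliminates `Y`. -/
lemma le_payloadEntropy [NeZero N] (hK : 2 ≤ K) (hμ : ∀ d, 0 < μ d)
    (hpos : S.IsCachePos pos) (hE : S.Encoding μ) (hP : S.PrivateAgainstCollusion μ) {δ s : ℝ}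
    (hδ : ∀ k d, ∑ ξ, S.metaLaw d ξ * S.equivocation k (d k) ξ ≤ δ)
    (hs : ∀ k, S.mean (fun c => #(pos k (c k))) ≤ s) (d : Demand K N)
    {n : ℕ} (hn1 : 1 ≤ n) (hn : n ≤ N) :
    n * ((K + n - 1) * (N * B - N * δ) - n * (K * s) - K * (N * δ)) ≤
      N * ((K - 1) * ∑ j, S.payloadEntropy d j) := by
  have h1 := Finset.sum_le_sum fun k (_ : k ∈ (univ : Finset (Fin K))) =>
    mean_le_payloadEntropy hK hμ hpos hE hP hδ k d hn
  have h2 : ∑ k, (N : ℝ) * ∑ j ∈ ({k}ᶜ : Finset (Fin K)), S.payloadEntropy d j =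
      N * ((K - 1) * ∑ j, S.payloadEntropy d j) := by
    rw [← Finset.mul_sum]
    congr 1
    have : ∀ k, ∑ j ∈ ({k}ᶜ : Finset (Fin K)), S.payloadEntropy d j =
        ∑ j, S.payloadEntropy d j - S.payloadEntropy d k := by
      intro k
      rw [← Finset.sum_compl_add_sum {k}, Finset.sum_singleton]
      ring
    simp only [this, Finset.sum_sub_distrib, Finset.sum_const, Finset.card_univ, Fintype.card_fin,
      nsmul_eq_mul]
    ring
  rw [h2] at h1
  refine le_trans ?_ h1
  rw [Finset.sum_sub_distrib, ← Finset.mul_sum, ← Finset.mul_sum, Finset.sum_sub_distrib,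
    Finset.sum_const, Finset.card_univ, Fintype.card_fin, nsmul_eq_mul]
  set A := S.mean fun c => (#(posAll pos c) : ℝ) with hA
  set Y := ∑ k, S.mean fun c => (#(posExcept pos k c ∩ pos k (c k)) : ℝ) with hY
  set T := ∑ k, S.mean fun c => (#(pos k (c k)) : ℝ) with hT
  have h3 : ∑ k, S.mean (fun c => (#(posExcept pos k c) : ℝ)) + T = K * A + Y := by
    have : ∀ k, S.mean (fun c => (#(posExcept pos k c) : ℝ)) + S.mean (fun c => #(pos k (c k))) =
        A + S.mean fun c => (#(posExcept pos k c ∩ pos k (c k)) : ℝ) := by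
      intro k
      rw [hA, ← mean_add, ← mean_add]
      congr 1
      funext c
      rw [← posExcept_union k c]
      exact_mod_cast (card_union_add_card_inter _ _).symm
    rw [hT, hY, ← Finset.sum_add_distrib, Finset.sum_congr rfl fun k _ => this k,
      Finset.sum_add_distrib, Finset.sum_const, Finset.card_univ, Fintype.card_fin, nsmul_eq_mul]
  have h4 : Y + 2 * A ≤ 2 * T := by
    have := mean_mono (S := S) fun c => sum_card_overlap_le (pos := pos) c
    rwa [mean_add, mean_mul_left, mean_mul_left, mean_sum, mean_sum] at this
  have h5 : N * B - N * δ ≤ A := le_mean_card_posAll hμ hpos hE hδ (by omega)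
  have h6 : T ≤ K * s := by
    have := Finset.sum_le_sum fun k (_ : k ∈ (univ : Finset (Fin K))) => hs k
    rwa [Finset.sum_const, Finset.card_univ, Fintype.card_fin, nsmul_eq_mul] at this
  have hn1' : (1 : ℝ) ≤ n := by exact_mod_cast hn1
  have hK' : (2 : ℝ) ≤ K := by exact_mod_cast hK
  have h7 : ((n : ℝ) - 1) / 2 * Y ≤ (n - 1) * (T - A) := by nlinarith
  have h8 : ((K : ℝ) + n - 1) * (N * B - N * δ) ≤ (K + n - 1) * A :=
    mul_le_mul_of_nonneg_left h5 (by linarith)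
  have h9 : (n : ℝ) * T ≤ n * (K * s) := mul_le_mul_of_nonneg_left h6 (by linarith)
  have h10 : (n : ℝ) * ((K + n - 1) * (N * B - N * δ) - n * (K * s) - K * (N * δ)) ≤
      n * ((∑ k, S.mean (fun c => (#(posExcept pos k c) : ℝ)) - K * (N * δ)) - (n + 1) / 2 * Y) := by
    refine mul_le_mul_of_nonneg_left ?_ (by linarith)
    have : ∑ k, S.mean (fun c => (#(posExcept pos k c) : ℝ)) = K * A + Y - T := by linarith
    rw [this]
    linarith
  refine h10.trans (le_of_eq ?_)
  ring

end D2DCaching.Scheme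

/-! ### The converse bound in the limit of large files. -/

namespace D2DCaching

variable {K N : ℕ} {μ : Demand K N → ℝ} {M R : ℝ}

/-- The converse bound: with `U = (K - 1) N` and `x = K M - N`, every achievable load is at least
`n (U - n x) / U` for `1 ≤ n ≤ N`. -/
theorem Achievable.le_load (hK : 2 ≤ K) (hμ : ∀ d, 0 < μ d) (hμ1 : ∑ d, μ d = 1)
    (h : Achievable K N μ M R) {n : ℕ} (hn1 : 1 ≤ n) (hn : n ≤ N) :
    n * ((K - 1) * N - n * (K * M - N)) ≤ (K - 1) * N * R := by
  obtain ⟨ε, hε0, hε, hS⟩ := h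
  have : NeZero N := ⟨by omega⟩
  -- The least likely demand gives one equivocation bound `B ε / μ d₀` for all demands.
  obtain ⟨d₀, -, hd₀⟩ := Finset.exists_min_image univ μ ⟨fun _ => 0, mem_univ _⟩
  have hm := hμ d₀
  set C : ℝ := n * ((K + n - 1) * (N / μ d₀) + n * K + K * (N / μ d₀)) + N * (K - 1) with hC
  have hlim : Tendsto (fun B => (K - 1) * N * R + C * ε B) atTop (𝓝 ((K - 1) * N * R + C * 0)) :=
    tendsto_const_nhds.add (hε.const_mul C)
  rw [mul_zero, add_zero] at hlim
  refine ge_of_tendsto hlim ?_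
  filter_upwards [hS, eventually_gt_atTop 0] with B hB hBpos
  obtain ⟨S, hU, hZ, hE, hD, hP, hL⟩ := hB
  obtain ⟨pos, hpos⟩ := hU.exists_isCachePos
  have hB' : (0 : ℝ) < B := by exact_mod_cast hBpos
  have hδ : ∀ k d, ∑ ξ, S.metaLaw d ξ * S.equivocation k (d k) ξ ≤ B * ε B / μ d₀ := fun k d =>
    (Scheme.sum_equivocation_le hμ hD k d).trans <|
      div_le_div_of_nonneg_left (mul_nonneg hB'.le (hε0 B)) hm (hd₀ d (mem_univ _))
  have h1 := fun d => Scheme.le_payloadEntropy hK hμ hpos hE hP hδ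
    (fun k => Scheme.sum_card_cachePos_le hμ hμ1 hpos hZ k) d hn1 hn
  have h2 : ∑ d, μ d * ∑ j, S.payloadEntropy d j ≤ B * (R + ε B) := by
    refine le_trans ?_ ((Finset.sum_le_sum fun k _ =>
      Scheme.sum_entropy_payload_le (S := S) hμ hμ1 k).trans hL)
    simp only [Finset.mul_sum]
    rw [Finset.sum_comm]
    simp only [Scheme.payloadEntropy, Finset.mul_sum, le_refl]
  have h3 := Finset.sum_le_sum fun d (_ : d ∈ (univ : Finset (Demand K N))) =>
    mul_le_mul_of_nonneg_left (h1 d) (hμ d).le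
  rw [← Finset.sum_mul, hμ1, one_mul] at h3
  have h4 : ∑ d, μ d * (N * ((K - 1) * ∑ j, S.payloadEntropy d j)) =
      N * (K - 1) * ∑ d, μ d * ∑ j, S.payloadEntropy d j := by
    rw [Finset.mul_sum]
    exact Finset.sum_congr rfl fun d _ => by ring
  rw [h4] at h3
  have hK' : (2 : ℝ) ≤ K := by exact_mod_cast hK
  have h5 := h3.trans (mul_le_mul_of_nonneg_left h2 (by
    have : (0 : ℝ) ≤ N := Nat.cast_nonneg _
    nlinarith))
  refine le_of_mul_le_mul_left ?_ hB'
  rw [hC]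
  have e1 : (B : ℝ) * ((K - 1) * N * R + (n * ((K + n - 1) * (N / μ d₀) + n * K + K * (N / μ d₀)) +
      N * (K - 1)) * ε B) = N * (K - 1) * (B * (R + ε B)) +
      n * ((K + n - 1) * (N * (B * ε B / μ d₀)) + n * (K * (B * ε B)) +
        K * (N * (B * ε B / μ d₀))) := by
    field_simp
    ring
  rw [e1]
  linarith

end D2DCaching

/-! ### The corner points of the scheme and the factor 18. -/

namespace D2DCaching

variable {K N : ℕ} {μ : Demand K N → ℝ} {M R : ℝ}

/-- The `a`-th corner point of Scheme A, `a = t - 1`. -/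
noncomputable def cornerLoad (K N a : ℕ) : ℝ :=
  ((((K - 1) * N).choose (a + 1) : ℝ) - (((K - 1) * N - N).choose (a + 1) : ℝ)) /
    (((K - 1) * N).choose a : ℝ)

lemma schemeAPoints_eq_range (K N : ℕ) : schemeAPoints K N =
    Set.range fun a : Fin ((K - 1) * N + 1) => (((N : ℝ) + a) / K, cornerLoad K N a) := by
  ext p
  constructor
  · rintro ⟨t, h1, h2, rfl⟩
    refine ⟨⟨t - 1, by omega⟩, ?_⟩
    simp only [cornerLoad, Nat.sub_add_cancel h1]
    push_cast [h1]
    rw [add_sub_assoc]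
  · rintro ⟨a, rfl⟩
    refine ⟨a + 1, by omega, by omega, ?_⟩
    simp only [cornerLoad, Nat.add_sub_cancel]
    push_cast
    rw [← add_assoc, add_sub_cancel_right]

lemma cornerLoad_nonneg (K N a : ℕ) : 0 ≤ cornerLoad K N a := by
  refine div_nonneg (sub_nonneg.2 ?_) (Nat.cast_nonneg _)
  exact_mod_cast Nat.choose_le_choose _ (Nat.sub_le _ _)

lemma cornerLoad_zero (hK : 2 ≤ K) : cornerLoad K N 0 = N := by
  have : N ≤ (K - 1) * N := Nat.le_mul_of_pos_left _ (by omega)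
  simp only [cornerLoad, zero_add, Nat.choose_one_right, Nat.choose_zero_right]
  push_cast [this]
  ring

lemma cornerLoad_last : cornerLoad K N ((K - 1) * N) = 0 := by
  simp only [cornerLoad]
  rw [Nat.choose_eq_zero_of_lt (by omega), Nat.choose_eq_zero_of_lt (by omega)]
  simp

lemma cornerLoad_le {a : ℕ} (ha : a ≤ (K - 1) * N) :
    cornerLoad K N a ≤ (((K - 1) * N : ℕ) - a) / (a + 1) := by
  have hpos : (0 : ℝ) < ((K - 1) * N).choose a := by exact_mod_cast Nat.choose_pos ha
  have h1 := Nat.choose_succ_right_eq ((K - 1) * N) a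
  have h2 : (((K - 1) * N).choose (a + 1) : ℝ) * (a + 1) =
      ((K - 1) * N).choose a * (((K - 1) * N : ℕ) - a) := by
    rw [← Nat.cast_sub ha]
    exact_mod_cast h1
  rw [cornerLoad, div_le_div_iff₀ hpos (by positivity)]
  have h3 : (0 : ℝ) ≤ (((K - 1) * N - N).choose (a + 1) : ℝ) := Nat.cast_nonneg _
  have h4 : (0 : ℝ) ≤ a + 1 := by positivity
  nlinarith

lemma bddBelow_convexHull (K N : ℕ) (M : ℝ) :
    BddBelow {y : ℝ | (M, y) ∈ convexHull ℝ (schemeAPoints K N)} := by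
  refine ⟨0, fun y hy => ?_⟩
  have h1 : convexHull ℝ (schemeAPoints K N) ⊆ {p | 0 ≤ p.2} := by
    refine convexHull_min ?_ (convex_halfSpace_ge (LinearMap.snd ℝ ℝ ℝ).isLinear 0)
    rw [schemeAPoints_eq_range]
    rintro _ ⟨a, rfl⟩
    exact cornerLoad_nonneg _ _ _
  exact h1 hy

/-- Memory sharing between two corner points. -/
lemma mem_convexHull_schemeAPoints (hK : 0 < K) {a b : ℕ} (ha : a ≤ (K - 1) * N) (hb : b ≤ (K - 1) * N)
    {s : ℝ} (hs0 : 0 ≤ s) (hs1 : s ≤ 1) (hM : K * M = N + (s * a + (1 - s) * b)) :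
    (M, s * cornerLoad K N a + (1 - s) * cornerLoad K N b) ∈
      convexHull ℝ (schemeAPoints K N) := by
  have hK' : (0 : ℝ) < K := by exact_mod_cast hK
  have h1 : ∀ c ≤ (K - 1) * N,
      (((N : ℝ) + c) / K, cornerLoad K N c) ∈ convexHull ℝ (schemeAPoints K N) := by
    intro c hc
    refine subset_convexHull ℝ _ ?_
    rw [schemeAPoints_eq_range]
    exact ⟨⟨c, by omega⟩, rfl⟩
  have h2 := convex_convexHull ℝ (schemeAPoints K N) (h1 a ha) (h1 b hb) hs0
    (sub_nonneg.2 hs1) (by ring)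
  have h3 : M = s * ((N + a) / K) + (1 - s) * ((N + b) / K) := by
    field_simp
    rw [mul_comm, hM]
    ring
  rw [h3]
  exact h2

lemma schemeALoad_le (hK : 0 < K) {a b : ℕ} (ha : a ≤ (K - 1) * N) (hb : b ≤ (K - 1) * N)
    {s : ℝ} (hs0 : 0 ≤ s) (hs1 : s ≤ 1) (hM : K * M = N + (s * a + (1 - s) * b)) :
    schemeALoad K N M ≤ s * cornerLoad K N a + (1 - s) * cornerLoad K N b :=
  csInf_le (bddBelow_convexHull K N M) (mem_convexHull_schemeAPoints hK ha hb hs0 hs1 hM)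

/-- The load of Scheme A is attained by memory sharing. -/
lemma exists_memorySharing (hK : 2 ≤ K) (hN : 2 ≤ N)
    (hM : M ∈ Set.Icc ((N : ℝ) / K) (N : ℝ)) :
    ∃ l : ℕ → ℝ, (∀ a, 0 ≤ l a) ∧ ∑ a ∈ range ((K - 1) * N + 1), l a = 1 ∧
      ∑ a ∈ range ((K - 1) * N + 1), l a * ((N + a) / K) = M ∧
      ∑ a ∈ range ((K - 1) * N + 1), l a * cornerLoad K N a = schemeALoad K N M := by
  have hK' : (2 : ℝ) ≤ K := by exact_mod_cast hK
  have hN' : (2 : ℝ) ≤ N := by exact_mod_cast hN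
  have hU : (((K - 1) * N : ℕ) : ℝ) = (K - 1) * N := by
    push_cast [show 1 ≤ K by omega]; ring
  -- The hull of finitely many points is closed, so the infimum defining the envelope is attained.
  have hclosed : IsClosed {y : ℝ | (M, y) ∈ convexHull ℝ (schemeAPoints K N)} := by
    refine IsClosed.preimage (f := fun y : ℝ => (M, y)) (by fun_prop) ?_
    rw [schemeAPoints_eq_range]
    exact (Set.finite_range _).isClosed_convexHull ℝ
  have hne : {y : ℝ | (M, y) ∈ convexHull ℝ (schemeAPoints K N)}.Nonempty := by
    have hd : (0 : ℝ) < (K - 1) * N := by nlinarith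
    have hM1 := (div_le_iff₀ (by linarith)).1 hM.1
    have hs0 : 0 ≤ (K * M - N) / ((K - 1) * N) := div_nonneg (by linarith) hd.le
    have hs1 : (K * M - N) / ((K - 1) * N) ≤ 1 := by
      rw [div_le_one hd]
      have := mul_le_mul_of_nonneg_left hM.2 (by linarith : (0 : ℝ) ≤ K)
      linarith
    refine ⟨_, mem_convexHull_schemeAPoints (by omega) le_rfl (Nat.zero_le _) hs0 hs1 ?_⟩
    rw [hU, div_mul_cancel₀ _ hd.ne']
    push_cast
    ring
  have hmem : (M, schemeALoad K N M) ∈ convexHull ℝ (schemeAPoints K N) :=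
    hclosed.csInf_mem hne (bddBelow_convexHull K N M)
  rw [schemeAPoints_eq_range, convexHull_range_eq_exists_affineCombination] at hmem
  obtain ⟨s, w, hw0, hw1, hw⟩ := hmem
  rw [Finset.affineCombination_eq_linear_combination _ _ _ hw1, Prod.ext_iff, Prod.fst_sum,
    Prod.snd_sum] at hw
  simp only [Prod.smul_mk, smul_eq_mul] at hw
  have key : ∀ φ : ℕ → ℝ, ∑ a ∈ range ((K - 1) * N + 1),
      (if h : a < (K - 1) * N + 1 then (if ⟨a, h⟩ ∈ s then w ⟨a, h⟩ else 0) else 0) * φ a =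
        ∑ i ∈ s, w i * φ i := by
    intro φ
    rw [Finset.sum_range, ← Finset.sum_subset (Finset.subset_univ s)]
    · exact Finset.sum_congr rfl fun i hi => by simp only [i.2, dif_pos, hi, if_true, Fin.eta]
    · intro i _ hi
      simp [hi]
  refine ⟨fun a => if h : a < (K - 1) * N + 1 then (if ⟨a, h⟩ ∈ s then w ⟨a, h⟩ else 0) else 0,
    fun a => ?_, ?_, ?_, ?_⟩
  · dsimp only
    split_ifs with h1 h2
    exacts [hw0 _ h2, le_rfl, le_rfl]
  · have := key fun _ => 1
    simp only [mul_one] at this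
    rw [this, hw1]
  · rw [key fun a => (N + a) / K, hw.1]
  · rw [key fun a => cornerLoad K N a, hw.2]

theorem schemeALoad_le_mul (hK : 2 ≤ K) (hN : 2 ≤ N) (hμ : ∀ d, 0 < μ d) (hμ1 : ∑ d, μ d = 1)
    (hM : M ∈ Set.Icc ((N : ℝ) / K) (N : ℝ)) (h : Achievable K N μ M R) :
    schemeALoad K N M ≤ 18 * R := by
  have hconv := fun n hn1 hn => h.le_load hK hμ hμ1 (n := n) hn1 hn
  have hK' : (2 : ℝ) ≤ K := by exact_mod_cast hK
  have hN' : (2 : ℝ) ≤ N := by exact_mod_cast hN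
  obtain ⟨x, hx⟩ : ∃ x : ℝ, x = K * M - N := ⟨_, rfl⟩
  have hU : (((K - 1) * N : ℕ) : ℝ) = (K - 1) * N := by
    push_cast [show 1 ≤ K by omega]; ring
  obtain ⟨U, hUdef⟩ : ∃ U : ℝ, U = (K - 1) * N := ⟨_, rfl⟩
  simp only [← hx, ← hUdef] at hconv
  have hU0 : 0 < U := by rw [hUdef]; nlinarith
  have hx0 : 0 ≤ x := by
    have := (div_le_iff₀ (by linarith)).1 hM.1
    linarith
  have hxU : x ≤ U := by
    have := mul_le_mul_of_nonneg_left hM.2 (by linarith : (0 : ℝ) ≤ K)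
    rw [hx, hUdef]; linarith
  have hMx : K * M = N + x := by rw [hx]; ring
  -- Small caches: `N x ≤ U / 2`, so `n = N` gives `R ≥ N / 2`, whereas the chord between the first
  -- and last corners bounds the scheme by `N`.
  by_cases hcase : 2 * x ≤ K - 1
  · have h1 := schemeALoad_le (N := N) (M := M) (by omega : 0 < K) (Nat.zero_le _) le_rfl
      (s := 1 - x / U) (by rw [sub_nonneg, div_le_one hU0]; exact hxU)
      (by have := div_nonneg hx0 hU0.le; linarith) (by
        rw [hMx, hU, ← hUdef]
        field_simp
        push_cast
        ring)
    rw [cornerLoad_zero hK, cornerLoad_last, mul_zero, add_zero] at h1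
    have h2 := hconv N (by omega) le_rfl
    have h3 : U / 2 ≤ U - N * x := by rw [hUdef]; nlinarith
    have h4 : U * (N / 2) ≤ U * R := by nlinarith
    have h5 := le_of_mul_le_mul_left h4 hU0
    have h6 : (1 - x / U) * N ≤ 1 * N :=
      mul_le_mul_of_nonneg_right (by have := div_nonneg hx0 hU0.le; linarith) (by linarith)
    linarith
  push Not at hcase
  have hxpos : 0 < x := by linarith
  -- Use the chord from the corner `⌊x⌋₊` to the last corner, whose load is zero. By `cornerLoad_le`
  -- its value at `x` is at most `(U - x) / (⌊x⌋₊ + 1)`. For `x = U` the chord degenerates, hence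
  -- the case split.
  have hA : schemeALoad K N M * x ≤ U - x := by
    rcases eq_or_lt_of_le hxU with hxe | hxlt
    · have h1 := schemeALoad_le (N := N) (M := M) (by omega : 0 < K) le_rfl le_rfl (s := 1)
        zero_le_one le_rfl (by rw [hMx, hU, ← hUdef, hxe]; ring)
      rw [cornerLoad_last] at h1
      have : schemeALoad K N M ≤ 0 := by linarith
      nlinarith
    · have hfl := Nat.floor_le hx0
      have hfl' := Nat.lt_floor_add_one x
      have hfU : (⌊x⌋₊ : ℝ) < U := lt_of_le_of_lt hfl hxlt
      have haU : ⌊x⌋₊ ≤ (K - 1) * N := by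
        rw [← @Nat.cast_le ℝ, hU, ← hUdef]; exact hfU.le
      have hd : 0 < U - ⌊x⌋₊ := by linarith
      have h1 := schemeALoad_le (N := N) (M := M) (by omega : 0 < K) haU le_rfl
        (s := (U - x) / (U - ⌊x⌋₊)) (div_nonneg (by linarith) hd.le)
        (by rw [div_le_one hd]; linarith) (by
          rw [hMx, hU, ← hUdef]
          field_simp
          ring)
      rw [cornerLoad_last, mul_zero, add_zero] at h1
      have h2 := cornerLoad_le haU
      rw [hU, ← hUdef] at h2
      have h3 : schemeALoad K N M ≤ (U - x) / (⌊x⌋₊ + 1) := by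
        refine h1.trans ((mul_le_mul_of_nonneg_left h2
          (div_nonneg (by linarith) hd.le)).trans (le_of_eq ?_))
        field_simp
      refine (mul_le_mul_of_nonneg_right h3 hx0).trans ?_
      rw [div_mul_eq_mul_div, div_le_iff₀ (by positivity)]
      exact mul_le_mul_of_nonneg_left hfl'.le (by linarith)
  have h1 := hconv 1 le_rfl (by omega)
  simp only [Nat.cast_one, one_mul] at h1
  have hR0 : 0 ≤ R := by
    by_contra hneg
    push Not at hneg
    nlinarith
  refine le_of_mul_le_mul_right ?_ hxpos
  -- Large caches: `n = 1` gives `U - x ≤ U R ≤ 4 x R`.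
  by_cases h4 : U ≤ 4 * x
  · nlinarith
  push Not at h4
  -- Intermediate caches: `n (z - n)` is largest near `n = z / 2`. From `z > 4` one gets `⌊z / 2⌋₊ ≥
  -- z / 4`, and `2 x > K - 1` gives `z / 2 ≤ N`. Hence `R ≥ z / 8`, against a scheme load of at
  -- most `z - 1`.
  obtain ⟨z, hz⟩ : ∃ z : ℝ, z = U / x := ⟨_, rfl⟩
  have hUz : U = z * x := by rw [hz]; field_simp
  have hz4 : 4 < z := by rw [hz, lt_div_iff₀ hxpos]; exact h4
  have hzN : z / 2 ≤ N := by
    rw [hz, div_div, div_le_iff₀ (by positivity), hUdef]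
    nlinarith
  have hfl := Nat.floor_le (show 0 ≤ z / 2 by linarith)
  have hfl' := Nat.lt_floor_add_one (z / 2)
  have hn : ⌊z / 2⌋₊ ≤ N := by
    rw [← @Nat.cast_le ℝ]; exact hfl.trans hzN
  have hn1 : 1 ≤ ⌊z / 2⌋₊ := (Nat.one_le_floor_iff _).2 (by linarith)
  have h5 := hconv _ hn1 hn
  set n : ℝ := (⌊z / 2⌋₊ : ℝ) with hndef
  rw [hUz] at h5 hA
  have h6 : n * (z - n) ≤ z * R := by
    refine le_of_mul_le_mul_right ?_ hxpos
    linarith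
  have h7 : z / 4 * (z / 2) ≤ n * (z - n) :=
    mul_le_mul (by linarith) (by linarith) (by linarith) (by linarith)
  have h8 : z * (z / 8) ≤ z * R := by linarith
  have h9 := le_of_mul_le_mul_left h8 (by linarith)
  nlinarith

end D2DCaching

namespace D2DCaching

/-! ### Linear relations between multicast messages. -/

section Redundancy

variable {V I : Type*} [DecidableEq V] [DecidableEq I] [Fintype I]

/-- The multicast message for the set `A` of users, user `u` demanding `dem u`, where `w i T` is the
piece of file `i` cached by the users in `T`. -/
def multicast (dem : V → I) (w : I → Finset V → ZMod 2) (A : Finset V) : ZMod 2 :=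
  ∑ u ∈ A, w (dem u) (A.erase u)

/-- The linear relation between the multicast messages for the complements in `A` of systems of
representatives of the demands. -/
lemma sum_multicast_sdiff_eq_zero (dem : V → I) (w : I → Finset V → ZMod 2) (A : Finset V) :
    ∑ τ ∈ Fintype.piFinset (fun i => A.filter fun u => dem u = i),
      multicast dem w (A \ univ.image τ) = 0 := by
  simp only [multicast]
  rw [Finset.sum_sigma']
  -- Exchange `u` with the representative `τ (dem u)` of its demand. Both terms involve the same
  -- file and the same set of remaining users, so they cancel in characteristic two.
  refine Finset.sum_involution
    (fun x _ => ⟨Function.update x.1 (dem x.2) x.2, x.1 (dem x.2)⟩) ?_ ?_ ?_ ?_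
  · rintro ⟨τ, u⟩ hx
    simp only [mem_sigma, Fintype.mem_piFinset, mem_filter, Finset.mem_sdiff, mem_image, mem_univ,
      true_and, not_exists] at hx
    obtain ⟨hτ, huA, hu⟩ := hx
    have h1 : dem (τ (dem u)) = dem u := (hτ _).2
    have h2 : (A \ univ.image (Function.update τ (dem u) u)).erase (τ (dem u)) =
        (A \ univ.image τ).erase u := by
      ext x
      simp only [mem_erase, Finset.mem_sdiff, mem_image, mem_univ, true_and, not_exists]
      constructor
      · rintro ⟨h3, h4, h5⟩
        refine ⟨fun h => h5 (dem u) (by simp [h]), h4, fun i hi => ?_⟩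
        by_cases hi' : i = dem u
        · exact h3 (by rw [← hi, hi'])
        · exact h5 i (by rw [Function.update_of_ne hi', hi])
      · rintro ⟨h3, h4, h5⟩
        refine ⟨fun h => h5 _ h.symm, h4, fun i hi => ?_⟩
        by_cases hi' : i = dem u
        · subst hi'
          rw [Function.update_self] at hi
          exact h3 hi.symm
        · rw [Function.update_of_ne hi'] at hi
          exact h5 i hi
    simp only [h1, h2]
    exact CharTwo.add_self_eq_zero _
  · rintro ⟨τ, u⟩ hx _ heq
    simp only [mem_sigma, Finset.mem_sdiff, mem_image, mem_univ, true_and, not_exists] at hx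
    simp only [Sigma.mk.injEq] at heq
    exact hx.2.2 _ (eq_of_heq heq.2)
  · rintro ⟨τ, u⟩ hx
    simp only [mem_sigma, Fintype.mem_piFinset, mem_filter, Finset.mem_sdiff, mem_image, mem_univ,
      true_and, not_exists] at hx ⊢
    obtain ⟨hτ, huA, hu⟩ := hx
    refine ⟨fun i => ?_, (hτ _).1, fun i hi => ?_⟩
    · by_cases hi : i = dem u
      · subst hi; simp [huA]
      · rw [Function.update_of_ne hi]; exact hτ i
    · by_cases hi' : i = dem u
      · subst hi'
        rw [Function.update_self] at hi
        exact hu _ hi.symm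
      · rw [Function.update_of_ne hi'] at hi
        have := (hτ i).2
        rw [hi, (hτ _).2] at this
        exact hi' this.symm
  · rintro ⟨τ, u⟩ hx
    simp only [mem_sigma, Fintype.mem_piFinset, mem_filter] at hx
    simp [(hx.1 _).2]

/-- The messages for sets of users without a leader are redundant. -/
lemma multicast_eq_zero {dem : V → I} {w : I → Finset V → ZMod 2} {E L : Finset V} (hLE : L ⊆ E)
    {lead : I → V} (hlead : ∀ i, dem (lead i) = i) (hL : univ.image lead = L)
    (h : ∀ A ⊆ E, (A ∩ L).Nonempty → multicast dem w A = 0) {A : Finset V} (hA : A ⊆ E) :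
    multicast dem w A = 0 := by
  by_cases hAL : (A ∩ L).Nonempty
  · exact h A hA hAL
  rw [Finset.not_nonempty_iff_eq_empty, ← Finset.disjoint_iff_inter_eq_empty] at hAL
  have hmem : lead ∈ Fintype.piFinset fun i => (A ∪ L).filter fun u => dem u = i := by
    simp only [Fintype.mem_piFinset, mem_filter, hlead, and_true, mem_union]
    exact fun i => .inr (hL ▸ mem_image_of_mem _ (mem_univ i))
  -- In the relation for `A ∪ L`, the system `lead` contributes the message for `A`; any other
  -- system leaves out some leader, so its message is for a set meeting `L` and vanishes.
  have h1 := sum_multicast_sdiff_eq_zero dem w (A ∪ L)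
  rw [Finset.sum_eq_single_of_mem lead hmem, hL, Finset.union_sdiff_right,
    Finset.sdiff_eq_self_of_disjoint hAL] at h1
  · exact h1
  · intro τ hτ hne
    simp only [Fintype.mem_piFinset, mem_filter] at hτ
    obtain ⟨i, hi⟩ := Function.ne_iff.1 hne
    refine h _ (Finset.sdiff_subset.trans (union_subset hA hLE)) ⟨lead i, ?_⟩
    have hiL : lead i ∈ L := hL ▸ mem_image_of_mem _ (mem_univ i)
    simp only [mem_inter, Finset.mem_sdiff, mem_union, hiL, or_true, true_and, and_true,
      mem_image, mem_univ, not_exists]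
    intro i' hi'
    have := (hτ i').2
    rw [hi', hlead] at this
    exact hi (by rw [← this] at hi'; exact hi')

end Redundancy

/-! ### Counting cells, cached cells and messages. -/

section Counting

variable {K N : ℕ}

/-- The virtual users served by user `j`: `N` copies of every other user. -/
def virtualUsers (N : ℕ) (j : Fin K) : Finset (Fin K × Fin N) := univ.filter fun u => u.1 ≠ j

/-- The copies of user `k`. -/
def copies (N : ℕ) (k : Fin K) : Finset (Fin K × Fin N) := univ.filter fun u => u.1 = k

lemma card_copies (k : Fin K) : #(copies N k) = N := by
  have : copies N k = {k} ×ˢ univ := by ext ⟨a, b⟩; simp [copies, eq_comm]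
  rw [this]; simp

lemma card_virtualUsers (j : Fin K) : #(virtualUsers N j) = (K - 1) * N := by
  have : virtualUsers N j = {j}ᶜ ×ˢ univ := by ext ⟨a, b⟩; simp [virtualUsers]
  rw [this]; simp [Finset.card_compl]

lemma copies_subset {j k : Fin K} (h : k ≠ j) : copies N k ⊆ virtualUsers N j := by
  intro u hu
  simp only [copies, virtualUsers, mem_filter, mem_univ, true_and] at hu ⊢
  rwa [hu]

/-- The cells `(j, S, i)` of a file: the `i`-th bit of the piece which is sent by user `j` and cached
by the virtual users in `S`; such a piece has `cnt #S` bits. -/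
def cells (K N : ℕ) (cnt : ℕ → ℕ) : Finset (Σ _ : Fin K, Σ _ : Finset (Fin K × Fin N), ℕ) :=
  univ.sigma fun j => (virtualUsers N j).powerset.sigma fun S => range (cnt #S)

lemma mem_cells {cnt : ℕ → ℕ} {j : Fin K} {S : Finset (Fin K × Fin N)} {i : ℕ} :
    (⟨j, S, i⟩ : Σ _ : Fin K, Σ _ : Finset (Fin K × Fin N), ℕ) ∈ cells K N cnt ↔
      S ⊆ virtualUsers N j ∧ i < cnt #S := by
  simp [cells]

lemma card_cells (cnt : ℕ → ℕ) : #(cells K N cnt) =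
    K * ∑ a ∈ range ((K - 1) * N + 1), ((K - 1) * N).choose a * cnt a := by
  simp only [cells, Finset.card_sigma, Finset.card_range]
  have : ∀ j : Fin K, ∑ S ∈ (virtualUsers N j).powerset, cnt #S =
      ∑ a ∈ range ((K - 1) * N + 1), ((K - 1) * N).choose a * cnt a := fun j => by
    rw [Finset.sum_powerset_apply_card, card_virtualUsers]
    simp only [smul_eq_mul]
  simp [this]

/-- The cells cached by user `k` playing the role of its copy `c`. -/
def cachedCells (cnt : ℕ → ℕ) (k : Fin K) (c : Fin N) :
    Finset (Σ _ : Fin K, Σ _ : Finset (Fin K × Fin N), ℕ) :=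
  (cells K N cnt).filter fun q => q.1 = k ∨ (k, c) ∈ q.2.1

lemma sum_powerset_mem {V : Type*} [DecidableEq V] (E : Finset V) {u : V} (hu : u ∈ E)
    (φ : ℕ → ℝ) : ∑ S ∈ E.powerset with u ∈ S, φ #S =
      ∑ a ∈ range (#E + 1), ((#E).choose a - (#E - 1).choose a : ℝ) * φ a := by
  have h1 := Finset.sum_filter_add_sum_filter_not E.powerset (fun S => u ∈ S) fun S => φ #S
  have h2 : (E.powerset.filter fun S => u ∉ S) = (E.erase u).powerset := by
    ext S
    simp [Finset.subset_erase]
  rw [h2, Finset.sum_powerset_apply_card, Finset.sum_powerset_apply_card, card_erase_of_mem hu] at h1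
  have hpos : 0 < #E := card_pos.2 ⟨u, hu⟩
  have h3 : ∑ a ∈ range (#E + 1), ((#E - 1).choose a : ℝ) * φ a =
      ∑ a ∈ range (#E - 1 + 1), (#E - 1).choose a • φ a := by
    rw [Nat.sub_add_cancel hpos, Finset.sum_range_succ, Nat.choose_eq_zero_of_lt (by omega)]
    simp
  simp only [sub_mul, Finset.sum_sub_distrib]
  rw [h3, eq_sub_iff_add_eq, h1]
  simp

lemma choose_sub_choose_pred {U a : ℕ} (hU : 0 < U) (ha : a ≤ U) :
    (U.choose a - (U - 1).choose a : ℝ) = U.choose a * (a / U) := by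
  have h1 := Nat.choose_mul_succ_eq (U - 1) a
  rw [Nat.sub_add_cancel hU] at h1
  have h2 : ((U - 1).choose a : ℝ) * U = U.choose a * (U - a) := by
    rw [← Nat.cast_sub ha]
    exact_mod_cast h1
  have hU' : (U : ℝ) ≠ 0 := by positivity
  field_simp
  linarith

/-- User `k` holds all cells it has to send, and of each of the other `K - 1` senders the fraction
`a / U` of the sets of size `a`; altogether `1 + a / N`. -/
lemma card_cachedCells (hK : 2 ≤ K) (hN : 0 < N) (cnt : ℕ → ℕ) (k : Fin K) (c : Fin N) :
    (#(cachedCells cnt k c) : ℝ) = ∑ a ∈ range ((K - 1) * N + 1),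
      ((K - 1) * N).choose a * cnt a * (1 + a / N : ℝ) := by
  have hU : 0 < (K - 1) * N := Nat.mul_pos (by omega) hN
  have h1 : cachedCells cnt k c = univ.sigma fun j =>
      ((virtualUsers N j).powerset.filter fun S => j = k ∨ (k, c) ∈ S).sigma
        fun S => range (cnt #S) := by
    ext ⟨j, S, i⟩
    simp only [cachedCells, mem_filter, mem_cells, mem_sigma, mem_univ, true_and, mem_powerset,
      mem_range]
    tauto
  have h2 : ∀ j ≠ k, ∑ S ∈ (virtualUsers N j).powerset with j = k ∨ (k, c) ∈ S, (cnt #S : ℝ) =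
      ∑ a ∈ range ((K - 1) * N + 1), (((K - 1) * N).choose a : ℝ) * (a / ((K - 1) * N : ℕ)) * cnt a := by
    intro j hj
    have h3 := sum_powerset_mem (virtualUsers N j) (u := (k, c))
      (by simpa [virtualUsers] using hj.symm) fun a => (cnt a : ℝ)
    rw [card_virtualUsers] at h3
    rw [Finset.sum_congr (s₂ := (virtualUsers N j).powerset.filter fun S => (k, c) ∈ S)
      (by ext; simp [hj]) fun _ _ => rfl, h3]
    refine Finset.sum_congr rfl fun a ha => ?_
    rw [choose_sub_choose_pred hU (by have := mem_range.1 ha; omega)]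
  have h4 : ∑ S ∈ (virtualUsers N k).powerset with k = k ∨ (k, c) ∈ S, (cnt #S : ℝ) =
      ∑ a ∈ range ((K - 1) * N + 1), (((K - 1) * N).choose a : ℝ) * cnt a := by
    simp only [true_or, Finset.filter_true]
    rw [Finset.sum_powerset_apply_card (fun a => (cnt a : ℝ)), card_virtualUsers]
    simp
  rw [h1]
  simp only [Finset.card_sigma, Finset.card_range]
  push_cast
  rw [← Finset.sum_compl_add_sum {k}, Finset.sum_singleton, h4,
    Finset.sum_congr rfl fun j hj => h2 j (by simpa using hj), Finset.sum_const,
    Finset.card_compl, card_singleton, Fintype.card_fin, nsmul_eq_mul, Finset.mul_sum,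
    ← Finset.sum_add_distrib]
  refine Finset.sum_congr rfl fun a _ => ?_
  have hK' : ((K - 1 : ℕ) : ℝ) ≠ 0 := by
    have : 0 < K - 1 := by omega
    positivity
  have hN' : (N : ℝ) ≠ 0 := by positivity
  push_cast
  field_simp
  ring

/-- The multicast messages sent by user `j` if the copies of user `k` are the leaders. -/
def messages (cnt : ℕ → ℕ) (j k : Fin K) : Finset (Σ _ : Finset (Fin K × Fin N), ℕ) :=
  ((virtualUsers N j).powerset.filter fun A => (A ∩ copies N k).Nonempty).sigma
    fun A => range (cnt (#A - 1))

lemma card_messages (hK : 2 ≤ K) (cnt : ℕ → ℕ) {j k : Fin K} (hjk : k ≠ j) :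
    (#(messages (N := N) cnt j k) : ℝ) = ∑ a ∈ range ((K - 1) * N + 1),
      ((((K - 1) * N).choose (a + 1) : ℝ) - (((K - 1) * N - N).choose (a + 1) : ℝ)) * cnt a := by
  set U := (K - 1) * N with hU
  have hNU : N ≤ U := Nat.le_mul_of_pos_left _ (by omega)
  have h1 := Finset.sum_filter_add_sum_filter_not (virtualUsers N j).powerset
    (fun A => (A ∩ copies N k).Nonempty) fun A => (cnt (#A - 1) : ℝ)
  have h2 : ((virtualUsers N j).powerset.filter fun A => ¬ (A ∩ copies N k).Nonempty) =
      (virtualUsers N j \ copies N k).powerset := by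
    ext A
    simp only [mem_filter, mem_powerset, Finset.not_nonempty_iff_eq_empty,
      ← Finset.disjoint_iff_inter_eq_empty, Finset.subset_sdiff]
  -- Truncated subtraction gives the empty set a spurious `cnt 0`; it occurs for all sets and for
  -- those avoiding the leaders, and cancels in the difference.
  have h3 : ∀ m : ℕ, ∀ V : ℕ, V ≤ m → ∑ b ∈ range (V + 1), (V.choose b : ℝ) * cnt (b - 1) =
      cnt 0 + ∑ a ∈ range (m + 1), (V.choose (a + 1) : ℝ) * cnt a := by
    intro m V hV
    rw [Finset.sum_range_succ']
    simp only [Nat.add_sub_cancel, Nat.choose_zero_right, Nat.cast_one, one_mul, Nat.zero_sub]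
    rw [add_comm]
    congr 1
    refine Finset.sum_subset (by intro x; simp only [mem_range]; omega) fun a _ ha => ?_
    rw [mem_range, not_lt] at ha
    rw [Nat.choose_eq_zero_of_lt (by omega)]
    simp
  rw [h2, Finset.sum_powerset_apply_card (fun a => (cnt (a - 1) : ℝ)),
    Finset.sum_powerset_apply_card (fun a => (cnt (a - 1) : ℝ)), card_virtualUsers,
    Finset.card_sdiff_of_subset (copies_subset hjk), card_copies, card_virtualUsers, ← hU] at h1
  simp only [nsmul_eq_mul] at h1
  rw [h3 U U le_rfl, h3 U (U - N) (Nat.sub_le _ _)] at h1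
  simp only [messages, Finset.card_sigma, Finset.card_range, sub_mul, Finset.sum_sub_distrib]
  push_cast
  linarith

end Counting

end D2DCaching

/-! ### The virtual user scheme and its decoding. -/

namespace D2DCaching

variable {K N B : ℕ}

/-- The indices of the cells. -/
abbrev Cell (K N : ℕ) : Type := Σ _ : Fin K, Σ _ : Finset (Fin K × Fin N), ℕ

/-- A bit as an element of the field with two elements. -/
def bitVal (b : Bool) : ZMod 2 := if b then 1 else 0

lemma bitVal_injective : Function.Injective bitVal := by decide

/-- The `i`-th bit of the multicast message of user `j` for the set `A` of virtual users, where the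
copy `m` of user `k` demands the file `s k + m`. -/
def messageBit (e : Cell K N → Fin B) (f : Library N B) (s : Demand K N) (j : Fin K)
    (A : Finset (Fin K × Fin N)) (i : ℕ) : ZMod 2 :=
  multicast (fun u => s u.1 + u.2) (fun n T => bitVal (f n (e ⟨j, T, i⟩))) A

/-- The positions inside each file of the bits cached by user `k` in the role of its copy `c`; the
bits outside the cells are cached by everybody. -/
def cachedBits (cnt : ℕ → ℕ) (e : Cell K N → Fin B) (k : Fin K) (c : Fin N) : Finset (Fin B) :=
  ((cells K N cnt).image e)ᶜ ∪ (cachedCells cnt k c).image e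

/-- Scheme A with arbitrary piece sizes: user `k` plays the role of a random one of its `N` copies,
and the server announces the shifts of the demands of the copies. -/
noncomputable def virtualUserScheme (cnt : ℕ → ℕ) (e : Cell K N → Fin B) (leader : Fin K → Fin K)
    (hN : 0 < N) : Scheme K N B where
  C _ := Fin N
  P _ := Demand K N
  fintypeC _ := inferInstance
  fintypeP _ := inferInstance
  placement _ := (1 / (N : ℝ)) ^ K
  placement_mem := by
    refine ⟨fun _ => by positivity, ?_⟩
    have : (N : ℝ) ≠ 0 := by positivity
    simp [this]
  query d c p := if p = fun _ k => d k - c k then 1 else 0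
  query_mem d c := by
    refine ⟨fun p => by dsimp only; split_ifs <;> norm_num, ?_⟩
    simp
  content k c f := ((univ : Finset (Fin N)) ×ˢ cachedBits cnt e k c).toList.map
    fun p => f p.1 p.2
  payload j s f := (messages cnt j (leader j)).toList.map
    fun q => decide (messageBit e f s j q.1 q.2 = 1)

variable {cnt : ℕ → ℕ} {e : Cell K N → Fin B} {leader : Fin K → Fin K} {hN : 0 < N}

local notation "𝓢" => virtualUserScheme cnt e leader hN

lemma virtualUserScheme_uncoded : (𝓢).Uncoded := fun _ _ => ⟨_, fun _ => rfl⟩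

lemma content_eq_iff {k : Fin K} {c : Fin N} {f f' : Library N B} :
    (𝓢).content k c f = (𝓢).content k c f' ↔
      ∀ n, ∀ b ∈ cachedBits cnt e k c, f n b = f' n b := by
  simp [virtualUserScheme, List.map_inj_left]

lemma payload_eq_iff {j : Fin K} {s : Demand K N} {f f' : Library N B} :
    (𝓢).payload j s f = (𝓢).payload j s f' ↔
      ∀ q ∈ messages cnt j (leader j), messageBit e f s j q.1 q.2 = messageBit e f' s j q.1 q.2 := by
  have h : ∀ x y : ZMod 2, decide (x = 1) = decide (y = 1) ↔ x = y := by decide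
  simp [virtualUserScheme, List.map_inj_left, h]

lemma cell_mem_cachedBits {k : Fin K} {c : Fin N} {q : Cell K N} (hq : q ∈ cells K N cnt)
    (h : q.1 = k ∨ (k, c) ∈ q.2.1) : e q ∈ cachedBits cnt e k c :=
  mem_union_right _ (mem_image_of_mem _ (mem_filter.2 ⟨hq, h⟩))

lemma payload_eq_of_content_eq {k : Fin K} {c : Fin N} {s : Demand K N} {f f' : Library N B}
    (h : (𝓢).content k c f = (𝓢).content k c f') :
    (𝓢).payload k s f = (𝓢).payload k s f' := by
  rw [content_eq_iff] at h
  rw [payload_eq_iff]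
  rintro ⟨A, i⟩ hq
  simp only [messages, mem_sigma, mem_filter, mem_powerset, mem_range] at hq
  refine Finset.sum_congr rfl fun u hu => ?_
  dsimp only
  rw [h _ _ (cell_mem_cachedBits (mem_cells.2 ⟨(Finset.erase_subset _ _).trans hq.1.1, ?_⟩)
    (.inl rfl))]
  rw [card_erase_of_mem hu]
  exact hq.2

/-- Messages are linear, so for two libraries with equal packets the messages of the difference
vanish, first for sets meeting the leaders and then for all sets. In the message for `insert (k, c
k) S` every term but the wanted one is cached by user `k`. -/
lemma file_eq_of_payload_eq (hl : ∀ j, leader j ≠ j) {k : Fin K} {c d s : Demand K N}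
    {f f' : Library N B} (hs : ∀ k, s k + c k = d k)
    (hc : (𝓢).content k (c k) f = (𝓢).content k (c k) f')
    (hp : ∀ j, (𝓢).payload j s f = (𝓢).payload j s f') : f (d k) = f' (d k) := by
  have : NeZero N := ⟨hN.ne'⟩
  rw [content_eq_iff] at hc
  funext b
  by_cases hb : b ∈ (cells K N cnt).image e
  swap
  · exact hc _ _ (mem_union_left _ (Finset.mem_compl.2 hb))
  obtain ⟨⟨j, S, i⟩, hq, rfl⟩ := mem_image.1 hb
  by_cases hcached : j = k ∨ (k, c k) ∈ S
  · exact hc _ _ (cell_mem_cachedBits hq hcached)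
  push Not at hcached
  obtain ⟨hjk, hkS⟩ := hcached
  rw [mem_cells] at hq
  have hp' := payload_eq_iff.1 (hp j)
  -- Bit `i` need not exist in pieces of other sizes, so the difference is cut off to sets of the
  -- size of `S`; messages for sets of other sizes than `#S + 1` then vanish trivially.
  let w : Fin N → Finset (Fin K × Fin N) → ZMod 2 := fun n T =>
    if #T = #S then bitVal (f n (e ⟨j, T, i⟩)) - bitVal (f' n (e ⟨j, T, i⟩)) else 0
  have hw : ∀ A ⊆ virtualUsers N j, (A ∩ copies N (leader j)).Nonempty →
      multicast (fun u : Fin K × Fin N => s u.1 + u.2) w A = 0 := by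
    intro A hA hAL
    by_cases hcard : #A = #S + 1
    · have h1 := hp' ⟨A, i⟩ (by
        simp only [messages, mem_sigma, mem_filter, mem_powerset, mem_range]
        exact ⟨⟨hA, hAL⟩, by rw [hcard, Nat.add_sub_cancel]; exact hq.2⟩)
      rw [← sub_eq_zero, messageBit, messageBit, multicast, multicast,
        ← Finset.sum_sub_distrib] at h1
      refine Eq.trans (Finset.sum_congr rfl fun u hu => ?_) h1
      simp only [w]
      rw [if_pos (by rw [card_erase_of_mem hu, hcard, Nat.add_sub_cancel])]
    · refine Finset.sum_eq_zero fun u hu => if_neg fun h => hcard ?_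
      rw [← card_erase_add_one hu, h]
  -- The copy `n - s (leader j)` of the leader is the one demanding file `n`.
  have hlead : univ.image (fun n : Fin N => (leader j, n - s (leader j))) =
      copies N (leader j) := by
    ext ⟨k', m⟩
    simp only [mem_image, mem_univ, true_and, copies, mem_filter, Prod.mk.injEq]
    constructor
    · rintro ⟨n, h, -⟩; exact h.symm
    · rintro rfl; exact ⟨m + s (leader j), rfl, add_sub_cancel_right _ _⟩
  have hA : insert (k, c k) S ⊆ virtualUsers N j :=
    insert_subset (by simpa [virtualUsers] using Ne.symm hjk) hq.1
  have h2 := multicast_eq_zero (copies_subset (hl j))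
    (lead := fun n : Fin N => (leader j, n - s (leader j)))
    (fun n => add_sub_cancel (s (leader j)) n) hlead hw hA
  rw [multicast, Finset.sum_insert hkS, erase_insert hkS, Finset.sum_eq_zero, add_zero] at h2
  · simp only [w, if_true, hs, sub_eq_zero] at h2
    exact bitVal_injective h2
  · intro u hu
    have hne : u ≠ (k, c k) := fun h => hkS (h ▸ hu)
    dsimp only [w]
    split_ifs with hcard
    · rw [hc _ _ (cell_mem_cachedBits (mem_cells.2 ⟨(Finset.erase_subset _ _).trans hA, ?_⟩)
        (.inr ?_)), sub_self]
      · rw [hcard]; exact hq.2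
      · exact mem_erase.2 ⟨hne.symm, mem_insert_self _ _⟩
    · rfl

section Constraints

variable {μ : Demand K N → ℝ}

lemma virtualUserScheme_encoding : (𝓢).Encoding μ := by
  intro k
  refine condEntropy_eq_zero fun ω ω' _ _ h => ?_
  simp only [Prod.mk.injEq, Scheme.Z] at h
  obtain ⟨h1, h2, h3⟩ := h
  simp only [Scheme.X, Prod.mk.injEq]
  refine ⟨h1, ?_⟩
  rw [← h2] at h3
  rw [← h1]
  exact payload_eq_of_content_eq h3

/-- The copies played by the users. -/
def roles (ω : (𝓢).Sample) : Demand K N := ω.2.1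

lemma eq_of_law_ne_zero {ω : (𝓢).Sample} (h : (𝓢).law μ ω ≠ 0) :
    ω.2.2.1 = fun _ k => ω.1 k - roles ω k := by
  by_contra hne
  refine h ?_
  simp only [Scheme.law]
  rw [show (𝓢).query ω.1 ω.2.1 ω.2.2.1 = 0 from if_neg hne]
  ring

lemma virtualUserScheme_decoding (hl : ∀ j, leader j ≠ j) {ε : ℝ} (hε : 0 ≤ ε) :
    (𝓢).Decoding μ ε := by
  have : NeZero N := ⟨hN.ne'⟩
  intro k
  rw [condEntropy_eq_zero]
  · positivity
  intro ω ω' hω hω' h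
  simp only [Prod.mk.injEq, Scheme.Z] at h
  obtain ⟨hX, ⟨hc, hcont⟩, hD⟩ := h
  have hX' := fun j => Prod.ext_iff.1 (congrFun hX j)
  simp only [Scheme.allX, Scheme.X, Scheme.metaP] at hX'
  rw [← hD]
  rw [← hc] at hcont
  refine file_eq_of_payload_eq (cnt := cnt) (e := e) (leader := leader) (hN := hN)
    (s := fun k => ω.1 k - roles ω k) (c := roles ω) hl
    (fun k => sub_add_cancel _ _) hcont fun j => ?_
  have h1 := (hX' j).2
  rw [← (hX' j).1] at h1
  have h2 := eq_of_law_ne_zero hω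
  rw [h2] at h1
  exact h1

end Constraints

end D2DCaching

/-! ### Privacy and entropies of the virtual user scheme. -/

namespace D2DCaching

variable {K N B : ℕ}

namespace Scheme

variable (S : Scheme K N B) {μ : Demand K N → ℝ} {α β : Type*}

/-- The law of `Y` given the demands `d`. -/
noncomputable def condProb (Y : S.Sample → α) (d : Demand K N) : α → ℝ :=
  prob (fun x : S.Meta × Library N B => S.metaLaw d x.1 * libraryLaw N B x.2)
    fun x => Y (S.sampleEquiv ((d, x.1), x.2))

lemma prob_law_prodMk [DecidableEq β] (Y : S.Sample → α) (A : Demand K N → β) (y : α) (a : β) :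
    prob (S.law μ) (fun ω => (Y ω, A (S.D ω))) (y, a) =
      ∑ d, if A d = a then μ d * S.condProb Y d y else 0 := by
  classical
  rw [prob_eq_sum_ite, ← S.sampleEquiv.sum_comp, Fintype.sum_prod_type, Fintype.sum_prod_type]
  refine Finset.sum_congr rfl fun d _ => ?_
  rw [condProb, prob_eq_sum_ite, Finset.mul_sum]
  simp only [law_sampleEquiv, Prod.mk.injEq]
  have : ∀ ξ f, S.D (S.sampleEquiv ((d, ξ), f)) = d := fun _ _ => rfl
  simp only [this]
  by_cases h : A d = a
  · simp only [h, and_true, if_true, mul_ite, mul_zero, mul_assoc]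
    exact (Fintype.sum_prod_type fun x : S.Meta × Library N B =>
      if Y (S.sampleEquiv ((d, x.1), x.2)) = y then
        μ d * (S.metaLaw d x.1 * libraryLaw N B x.2) else 0).symm
  · simp [h]

lemma prob_law_demand [DecidableEq β] (A : Demand K N → β) (a : β) :
    prob (S.law μ) (fun ω => A (S.D ω)) a = ∑ d, if A d = a then μ d else 0 := by
  have h1 := S.prob_law_prodMk (μ := μ) (fun _ => ()) A () a
  have h2 : ∀ d, S.condProb (fun _ => ()) d () = 1 := by
    intro d
    have := S.sum_metaLaw_mul d fun _ => 1
    simp only [mul_one, S.placement_mem.2] at this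
    simp [condProb, prob, Fintype.sum_prod_type, ← Finset.mul_sum, sum_libraryLaw, this]
  simp only [h2, mul_one] at h1
  rw [← h1]
  rw [prob, prob]
  exact Finset.sum_congr (by ext; simp) fun _ _ => rfl

/-- A scheme is private if what colluding users observe depends only on their own demands. -/
lemma privateAgainstCollusion_of_condProb_eq (hμ : ∀ d, 0 < μ d)
    (h : ∀ (T : Finset (Fin K)) (d d' : Demand K N), (∀ k ∈ T, d k = d' k) → ∀ y,
      S.condProb (fun ω => (S.allX ω, fun k : T => S.Z k ω)) d y =
        S.condProb (fun ω => (S.allX ω, fun k : T => S.Z k ω)) d' y) :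
    S.PrivateAgainstCollusion μ := by
  classical
  intro T _
  refine condMutualInfo_eq_zero (S.law_nonneg hμ) fun ω _ => ?_
  obtain ⟨d, hd⟩ : ∃ d, d = S.D ω := ⟨_, rfl⟩
  obtain ⟨y, hy⟩ : ∃ y, y = (S.allX ω, fun k : T => S.Z k ω) := ⟨_, rfl⟩
  rw [← hd, ← hy]
  have h1 := S.prob_law_prodMk (μ := μ) (fun ω => (S.allX ω, fun k : T => S.Z k ω))
    (fun d => (d, fun k : T => d k)) y (d, fun k : T => d k)
  have h2 := S.prob_law_prodMk (μ := μ) (fun ω => (S.allX ω, fun k : T => S.Z k ω))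
    (fun d => fun k : T => d k) y (fun k : T => d k)
  have h3 := S.prob_law_demand (μ := μ) (fun d => (d, fun k : T => d k)) (d, fun k : T => d k)
  have h4 := S.prob_law_demand (μ := μ) (fun d => fun k : T => d k) (fun k : T => d k)
  have h5 : prob (S.law μ) (fun ω => (S.D ω, (S.allX ω, fun k : T => S.Z k ω),
      fun k : T => S.D ω k)) (d, y, fun k : T => d k) =
      prob (S.law μ) (fun ω => ((S.allX ω, fun k : T => S.Z k ω),
        (S.D ω, fun k : T => S.D ω k))) (y, d, fun k : T => d k) := by
    simp only [prob_eq_sum_ite, Prod.mk.injEq]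
    refine Finset.sum_congr rfl fun ω _ => if_congr ?_ rfl rfl
    tauto
  rw [h5, h1, h2, h3, h4]
  have h6 : ∀ φ : Demand K N → ℝ,
      (∑ d', if (d', fun k : T => d' k) = (d, fun k : T => d k) then φ d' else 0) = φ d := by
    intro φ
    rw [Finset.sum_eq_single d (fun d' _ hne => by simp [hne]) (by simp)]
    simp
  rw [h6, h6, mul_assoc, Finset.mul_sum]
  congr 1
  refine Finset.sum_congr rfl fun d' _ => ?_
  by_cases hT : (fun k : T => d' k) = fun k : T => d k
  · simp only [hT, if_true]
    rw [h T d d' (fun k hk => (congrFun hT ⟨k, hk⟩).symm), mul_comm]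
  · simp [hT]

end Scheme

variable {cnt : ℕ → ℕ} {e : Cell K N → Fin B} {leader : Fin K → Fin K} {hN : 0 < N}
  {μ : Demand K N → ℝ}

local notation "𝓢" => virtualUserScheme cnt e leader hN

/-- The shifts announced by the server. -/
def shifts (d c : Demand K N) (_ : Fin K) : Demand K N := fun k => d k - c k

/-- Translating the roles by `d' - d` preserves their uniform law, keeps the announced shifts when
`d` is replaced by `d'`, and fixes the roles of the users in `T`, where the demands agree. -/
lemma virtualUserScheme_private (hμ : ∀ d, 0 < μ d) : (𝓢).PrivateAgainstCollusion μ := by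
  classical
  have : NeZero N := ⟨hN.ne'⟩
  refine Scheme.privateAgainstCollusion_of_condProb_eq _ hμ fun T d d' hT y => ?_
  have h1 : ∀ δ : Demand K N,
      (𝓢).condProb (fun ω => ((𝓢).allX ω, fun k : T => (𝓢).Z k ω)) δ y =
      ∑ c : Demand K N, ∑ f : Library N B,
        if ((𝓢).allX ((𝓢).sampleEquiv ((δ, (c, shifts δ c)), f)),
          fun k : T => (𝓢).Z k ((𝓢).sampleEquiv ((δ, (c, shifts δ c)), f))) = y
        then (1 / (N : ℝ)) ^ K * libraryLaw N B f else 0 := by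
    intro δ
    rw [Scheme.condProb, prob_eq_sum_ite, Fintype.sum_prod_type, Fintype.sum_prod_type]
    refine Finset.sum_congr rfl fun c _ => ?_
    refine (Finset.sum_eq_single (shifts δ c) (fun p _ hp => ?_)
      fun h => absurd (mem_univ _) h).trans ?_
    · refine Finset.sum_eq_zero fun f _ => ?_
      have : (𝓢).metaLaw δ (c, p) = 0 := by
        rw [Scheme.metaLaw, show (𝓢).query δ c p = 0 from if_neg hp, mul_zero]
      simp [this]
    · have : (𝓢).metaLaw δ (c, shifts δ c) = (1 / (N : ℝ)) ^ K := by
        rw [Scheme.metaLaw, show (𝓢).query δ c (shifts δ c) = 1 from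
          if_pos rfl, mul_one]
        rfl
      simp only [this]
  rw [h1, h1, ← Equiv.sum_comp (Equiv.addRight (d' - d)) (fun c : Demand K N => ∑ f : Library N B,
        if ((𝓢).allX ((𝓢).sampleEquiv ((d', (c, shifts d' c)), f)),
          fun k : T => (𝓢).Z k ((𝓢).sampleEquiv ((d', (c, shifts d' c)), f))) = y
        then (1 / (N : ℝ)) ^ K * libraryLaw N B f else 0)]
  refine Finset.sum_congr rfl fun c _ => Finset.sum_congr rfl fun f _ => ?_
  have h2 : shifts d' (Equiv.addRight (d' - d) c) = shifts d c := by
    funext _ k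
    simp only [shifts, Equiv.coe_addRight, Pi.add_apply, Pi.sub_apply]
    abel
  rw [h2]
  have h3 : (fun k : T => (𝓢).Z k
      ((𝓢).sampleEquiv ((d', (Equiv.addRight (d' - d) c, shifts d c)), f))) =
      fun k : T => (𝓢).Z k ((𝓢).sampleEquiv ((d, (c, shifts d c)), f)) := by
    funext k
    have h4 : (Equiv.addRight (d' - d) c) k = c k := by
      simp [hT k k.2]
    simp only [Scheme.Z, Scheme.sampleEquiv, Scheme.F, Equiv.coe_fn_mk]
    rw [h4]
  rw [h3]
  rfl

/-- The shifts take `N ^ K` values, and each message contributes one bit. -/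
lemma entropy_X_le (hμ : ∀ d, 0 < μ d) (hμ1 : ∑ d, μ d = 1) (k : Fin K) :
    entropy ((𝓢).law μ) ((𝓢).X k) ≤ K * Real.logb 2 N + #(messages (N := N) cnt k (leader k)) := by
  have h := entropy_le_logb_card ((𝓢).law_nonneg hμ) ((𝓢).sum_law hμ1)
    (X := (𝓢).X k) (T := Demand K N × (messages (N := N) cnt k (leader k) → Bool))
    (fun ω => (ω.2.2.1 k, fun q => decide (messageBit e ω.2.2.2 (ω.2.2.1 k) k q.1.1 q.1.2 = 1)))
    (by
      intro ω ω' hω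
      obtain ⟨h1, h2⟩ := Prod.ext_iff.1 hω
      refine Prod.ext h1 ?_
      change List.map _ _ = List.map _ _
      refine List.map_congr_left fun q hq => ?_
      exact congrFun h2 ⟨q, by simpa using hq⟩)
  refine h.trans (le_of_eq ?_)
  have hN' : (N : ℝ) ≠ 0 := by positivity
  rw [Fintype.card_prod, Fintype.card_fun, Fintype.card_fun, Fintype.card_fin, Fintype.card_fin,
    Fintype.card_bool, Fintype.card_coe]
  push_cast
  rw [Real.logb_mul (by positivity) (by positivity), Real.logb_pow, Real.logb_pow,
    Real.logb_self_eq_one (by norm_num), mul_one]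

lemma entropy_Z_le (hμ : ∀ d, 0 < μ d) (hμ1 : ∑ d, μ d = 1) (k : Fin K) {m : ℕ}
    (hm : ∀ c, N * #(cachedBits (N := N) cnt e k c) ≤ m) :
    entropy ((𝓢).law μ) ((𝓢).Z k) ≤ Real.logb 2 N + m := by
  have h := entropy_le_logb_card ((𝓢).law_nonneg hμ) ((𝓢).sum_law hμ1)
    (X := (𝓢).Z k) (T := Σ c : Fin N,
      (((univ : Finset (Fin N)) ×ˢ cachedBits cnt e k c : Finset (Fin N × Fin B)) → Bool))
    (fun ω => ⟨ω.2.1 k, fun p => ω.2.2.2 p.1.1 p.1.2⟩) (by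
      intro ω ω' hω
      simp only [Scheme.Z, Scheme.F, Prod.mk.injEq]
      obtain ⟨h1, h2⟩ := Sigma.mk.inj hω
      refine ⟨h1, ?_⟩
      have h3 : ∀ c c' : Fin N, c = c' → ∀ f f' : Library N B,
          HEq (fun p : ((univ : Finset (Fin N)) ×ˢ cachedBits cnt e k c : Finset (Fin N × Fin B)) =>
            f p.1.1 p.1.2)
          (fun p : ((univ : Finset (Fin N)) ×ˢ cachedBits cnt e k c' : Finset (Fin N × Fin B)) =>
            f' p.1.1 p.1.2) → (𝓢).content k c f = (𝓢).content k c' f' := by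
        rintro c _ rfl f f' hf
        refine List.map_congr_left fun q hq => ?_
        exact congrFun (eq_of_heq hf) ⟨q, by simpa using hq⟩
      exact h3 _ _ h1 _ _ h2)
  have hN' : (0 : ℝ) < N := by positivity
  refine h.trans ?_
  rw [Fintype.card_sigma]
  simp only [Fintype.card_fun, Fintype.card_bool, Fintype.card_coe, card_product, card_univ,
    Fintype.card_fin]
  have h1 : ∑ c : Fin N, 2 ^ (N * #(cachedBits (N := N) cnt e k c)) ≤ N * 2 ^ m := by
    refine (Finset.sum_le_sum fun c _ => Nat.pow_le_pow_right (by norm_num) (hm c)).trans ?_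
    simp
  have h2 : 0 < ∑ c : Fin N, 2 ^ (N * #(cachedBits (N := N) cnt e k c)) := by
    have : Nonempty (Fin N) := ⟨⟨0, hN⟩⟩
    exact Finset.sum_pos (fun c _ => by positivity) univ_nonempty
  refine (Real.logb_le_logb_of_le (by norm_num) (by exact_mod_cast h2)
    (Nat.cast_le.2 h1)).trans (le_of_eq ?_)
  push_cast
  rw [Real.logb_mul hN'.ne' (by positivity), Real.logb_pow, Real.logb_self_eq_one (by norm_num),
    mul_one]

end D2DCaching

/-! ### Memory sharing and achievability. -/

namespace D2DCaching

variable {K N B : ℕ} {μ : Demand K N → ℝ} {M R : ℝ}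

/-- The size of the pieces cached by `a` virtual users, when the fraction `l a` of each file is
handled as at the `a`-th corner point. -/
noncomputable def pieceSize (K N B : ℕ) (l : ℕ → ℝ) (a : ℕ) : ℕ :=
  ⌊l a * B / (K * ((K - 1) * N).choose a)⌋₊

variable {l : ℕ → ℝ}

lemma choose_mul_pieceSize_le (hK : 0 < K) (hl : ∀ a, 0 ≤ l a) {a : ℕ} (ha : a ≤ (K - 1) * N) :
    K * (((K - 1) * N).choose a * (pieceSize K N B l a : ℝ)) ≤ l a * B := by
  have hc : (0 : ℝ) < ((K - 1) * N).choose a := by exact_mod_cast Nat.choose_pos ha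
  have hK' : (0 : ℝ) < K := by exact_mod_cast hK
  have h := Nat.floor_le (show 0 ≤ l a * B / (K * ((K - 1) * N).choose a) from
    div_nonneg (mul_nonneg (hl a) (Nat.cast_nonneg _)) (by positivity))
  rw [le_div_iff₀ (by positivity)] at h
  rw [pieceSize]
  linarith

lemma le_choose_mul_pieceSize (hK : 0 < K) {a : ℕ} (ha : a ≤ (K - 1) * N) :
    l a * B - K * ((K - 1) * N).choose a ≤
      K * (((K - 1) * N).choose a * (pieceSize K N B l a : ℝ)) := by
  have hc : (0 : ℝ) < ((K - 1) * N).choose a := by exact_mod_cast Nat.choose_pos ha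
  have hK' : (0 : ℝ) < K := by exact_mod_cast hK
  have h := (Nat.lt_floor_add_one (l a * B / (K * ((K - 1) * N).choose a))).le
  rw [div_le_iff₀ (by positivity)] at h
  rw [pieceSize]
  linarith

lemma card_cells_pieceSize_le (hK : 0 < K) (hl : ∀ a, 0 ≤ l a)
    (hl1 : ∑ a ∈ range ((K - 1) * N + 1), l a = 1) : #(cells K N (pieceSize K N B l)) ≤ B := by
  have h : (#(cells K N (pieceSize K N B l)) : ℝ) ≤ B := by
    rw [card_cells]
    push_cast
    rw [Finset.mul_sum]
    refine (Finset.sum_le_sum fun a ha => choose_mul_pieceSize_le (B := B) hK hl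
      (by have := mem_range.1 ha; omega)).trans ?_
    rw [← Finset.sum_mul, hl1, one_mul]
  exact_mod_cast h

lemma card_cachedBits_le (hK : 2 ≤ K) (hN : 0 < N) (hl : ∀ a, 0 ≤ l a)
    (hl1 : ∑ a ∈ range ((K - 1) * N + 1), l a = 1)
    (hlM : ∑ a ∈ range ((K - 1) * N + 1), l a * ((N + a) / K) = M)
    {e : Cell K N → Fin B} (he : Set.InjOn e (cells K N (pieceSize K N B l))) (k : Fin K)
    (c : Fin N) :
    (N * #(cachedBits (pieceSize K N B l) e k c) : ℝ) ≤ B * M +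
      N * ∑ a ∈ range ((K - 1) * N + 1), (K * ((K - 1) * N).choose a : ℝ) := by
  have hN' : (0 : ℝ) < N := by exact_mod_cast hN
  have hK' : (0 : ℝ) < K := by positivity
  -- Rounding loses at most one bit per sender and set of virtual users, so the bits left over,
  -- cached by everybody, are bounded independently of `B`.
  have h1 : (#((cells K N (pieceSize K N B l)).image e)ᶜ : ℝ) ≤
      ∑ a ∈ range ((K - 1) * N + 1), (K * ((K - 1) * N).choose a : ℝ) := by
    rw [Finset.card_compl, Finset.card_image_of_injOn he, Fintype.card_fin,
      Nat.cast_sub (card_cells_pieceSize_le (by omega) hl hl1), card_cells]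
    push_cast
    rw [Finset.mul_sum, sub_le_iff_le_add, ← Finset.sum_add_distrib]
    calc (B : ℝ) = ∑ a ∈ range ((K - 1) * N + 1), l a * B := by
          rw [← Finset.sum_mul, hl1, one_mul]
      _ ≤ _ := Finset.sum_le_sum fun a ha => by
          have := le_choose_mul_pieceSize (B := B) (l := l) (N := N) (by omega : 0 < K)
            (a := a) (by have := mem_range.1 ha; omega)
          linarith
  have h2 : (N * #(cachedCells (pieceSize K N B l) k c) : ℝ) ≤ B * M := by
    rw [card_cachedCells hK hN, Finset.mul_sum, ← hlM, Finset.mul_sum]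
    refine Finset.sum_le_sum fun a ha => ?_
    have h3 := choose_mul_pieceSize_le (B := B) (by omega : 0 < K) hl
      (by have := mem_range.1 ha; omega : a ≤ (K - 1) * N)
    have h4 : (0 : ℝ) ≤ (N + a) / K := by positivity
    have h5 := mul_le_mul_of_nonneg_right h3 h4
    refine le_trans (le_of_eq ?_) (h5.trans (le_of_eq ?_))
    · field_simp
    · ring
  have h6 : (#(cachedBits (pieceSize K N B l) e k c) : ℝ) ≤
      #((cells K N (pieceSize K N B l)).image e)ᶜ + #(cachedCells (pieceSize K N B l) k c) := by
    exact_mod_cast (card_union_le _ _).trans (Nat.add_le_add_left card_image_le _)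
  have h7 := mul_le_mul_of_nonneg_left (h6.trans (add_le_add_left h1 _)) hN'.le
  linarith

lemma card_messages_pieceSize_le (hK : 2 ≤ K) (hl : ∀ a, 0 ≤ l a)
    (hlR : ∑ a ∈ range ((K - 1) * N + 1), l a * cornerLoad K N a = R) {j k : Fin K} (hjk : k ≠ j) :
    (K * #(messages (N := N) (pieceSize K N B l) j k) : ℝ) ≤ B * R := by
  rw [card_messages hK _ hjk, ← hlR, Finset.mul_sum, Finset.mul_sum]
  refine Finset.sum_le_sum fun a ha => ?_
  have ha' : a ≤ (K - 1) * N := by have := mem_range.1 ha; omega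
  have hc : (0 : ℝ) < ((K - 1) * N).choose a := by exact_mod_cast Nat.choose_pos ha'
  have h1 := mul_le_mul_of_nonneg_right (choose_mul_pieceSize_le (B := B) (by omega : 0 < K) hl ha')
    (cornerLoad_nonneg K N a)
  refine le_trans (le_of_eq ?_) (h1.trans (le_of_eq ?_))
  · rw [cornerLoad]; field_simp
  · ring

/-- The load of Scheme A is achievable. -/
theorem achievable_schemeALoad (hK : 2 ≤ K) (hN : 2 ≤ N) (hμ : ∀ d, 0 < μ d)
    (hμ1 : ∑ d, μ d = 1) (hM : M ∈ Set.Icc ((N : ℝ) / K) (N : ℝ)) :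
    Achievable K N μ M (schemeALoad K N M) := by
  classical
  obtain ⟨l, hl, hl1, hlM, hlR⟩ := exists_memorySharing hK hN hM
  have hlog : 0 ≤ Real.logb 2 N := Real.logb_nonneg (by norm_num) (by norm_cast; omega)
  obtain ⟨C, hC⟩ : ∃ C : ℝ, C = N * ∑ a ∈ range ((K - 1) * N + 1),
    (K * ((K - 1) * N).choose a : ℝ) := ⟨_, rfl⟩
  have hC0 : 0 ≤ C := by rw [hC]; positivity
  -- The excess covers the shifts sent by the `K` users, the role stored in a cache, the leftover
  -- bits `C`, and 1 for rounding the cache size up to an integer.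
  refine ⟨fun B => (K * (K * Real.logb 2 N) + (Real.logb 2 N + (C + 1))) / B,
    fun B => by positivity, tendsto_const_div_atTop_nhds_zero_nat _, ?_⟩
  filter_upwards [eventually_gt_atTop 0] with B hB
  have hB' : (B : ℝ) ≠ 0 := by positivity
  have : Nontrivial (Fin K) := Fin.nontrivial_iff_two_le.2 hK
  choose leader hleader using fun j : Fin K => exists_ne j
  obtain ⟨e, he⟩ : ∃ e : Cell K N → Fin B, Set.InjOn e (cells K N (pieceSize K N B l)) := by
    have h1 := card_cells_pieceSize_le (K := K) (N := N) (B := B) (by omega) hl hl1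
    obtain ⟨g⟩ := Function.Embedding.nonempty_of_card_le
      (α := cells K N (pieceSize K N B l)) (β := Fin B) (by simpa using h1)
    refine ⟨fun q => if h : q ∈ cells K N (pieceSize K N B l) then g ⟨q, h⟩ else ⟨0, hB⟩, ?_⟩
    intro q hq q' hq' h
    have hq1 : q ∈ cells K N (pieceSize K N B l) := hq
    have hq2 : q' ∈ cells K N (pieceSize K N B l) := hq'
    simp only [hq1, hq2, dif_pos] at h
    exact congrArg Subtype.val (g.injective h)
  refine ⟨virtualUserScheme (pieceSize K N B l) e leader (by omega), virtualUserScheme_uncoded,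
    fun k => ?_, virtualUserScheme_encoding,
    virtualUserScheme_decoding hleader (by positivity), virtualUserScheme_private hμ, ?_⟩
  · have h1 : ∀ c, N * #(cachedBits (N := N) (pieceSize K N B l) e k c) ≤ ⌈B * M + C⌉₊ := by
      intro c
      have h2 := card_cachedBits_le hK (by omega) hl hl1 hlM he k c
      rw [← hC] at h2
      exact_mod_cast h2.trans (Nat.le_ceil _)
    have h3 := entropy_Z_le (cnt := pieceSize K N B l) (leader := leader) (hN := by omega)
      hμ hμ1 k h1
    have hM0 : 0 ≤ M := le_trans (by positivity) hM.1
    have h4 := Nat.ceil_lt_add_one (show 0 ≤ B * M + C by positivity)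
    refine h3.trans ?_
    rw [mul_add, mul_div_cancel₀ _ hB']
    have : 0 ≤ K * (K * Real.logb 2 N) := by positivity
    linarith
  · have h1 := Finset.sum_le_sum fun k (_ : k ∈ (univ : Finset (Fin K))) =>
      entropy_X_le (cnt := pieceSize K N B l) (e := e) (leader := leader) (hN := by omega)
        hμ hμ1 k
    refine h1.trans ?_
    have hK' : (0 : ℝ) < K := by positivity
    have h2 : ∀ k : Fin K, (#(messages (N := N) (pieceSize K N B l) k (leader k)) : ℝ) ≤
        B * schemeALoad K N M / K := by
      intro k
      rw [le_div_iff₀ hK', mul_comm]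
      exact card_messages_pieceSize_le hK hl hlR (hleader k)
    refine (Finset.sum_le_sum fun k _ => add_le_add_right (h2 k) _).trans ?_
    rw [Finset.sum_const, Finset.card_univ, Fintype.card_fin, nsmul_eq_mul, mul_add, mul_add,
      mul_div_cancel₀ _ hK'.ne', mul_div_cancel₀ _ hB']
    linarith

end D2DCaching

/-- Scheme A is order optimal within a factor of `18` under uncoded cache placement and user
collusion: its load is achievable, and it is at most `18` times the optimal load. -/
theorem corollary2 (K N : ℕ) (hK : 2 ≤ K) (hN : 2 ≤ N)
    (μ : D2DCaching.Demand K N → ℝ) (hμ_pos : ∀ d, 0 < μ d) (hμ_sum : ∑ d, μ d = 1)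
    (M : ℝ) (hM : M ∈ Set.Icc ((N : ℝ) / K) (N : ℝ)) :
    D2DCaching.Achievable K N μ M (D2DCaching.schemeALoad K N M) ∧
      D2DCaching.schemeALoad K N M ≤ 18 * D2DCaching.optimalLoad K N μ M := by
  have hA := D2DCaching.achievable_schemeALoad hK hN hμ_pos hμ_sum hM
  refine ⟨hA, ?_⟩
  rw [← div_le_iff₀' (by norm_num)]
  refine le_csInf ⟨_, hA⟩ fun R hR => ?_
  rw [div_le_iff₀' (by norm_num)]
  exact D2DCaching.schemeALoad_le_mul hK hN hμ_pos hμ_sum hM hR
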